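/- Let $s\ge 2$ be real and $m=\lfloor s\rfloor$. Let $v:\mathbb R\to\mathbb C$ be $s$-times differentiable, meaning that $v$ has continuous derivatives up to order $m$ and that, for every $t_0\in\mathbb R$, $v^{(m)}(t)=v^{(m)}(t_0)+o(|t-t_0|^{s-m})$ as $t\to t_0$. Assume $v(0)=1$, $v'(0)=0$, $v''(0)=-1$, and that $v(t)\ne 0$ for $|t|\le c$, where $c>0$. Let $\log v$ be the continuous branch of the logarithm, vanishing at $0$, on the largest open interval around $0$ on which $v$ has no zeros (it contains $[-c,c]$), and for real $z\neq 0$ put $$v_z(t)=v(tz)^{1/z^2}=\exp\Big(\frac{1}{z^2}\log v(tz)\Big).$$ Let $\gamma_k = i^{-k}\frac{d^k}{dt^k}\log v(t)\big|_{t=0}$ ($3\le k\le m$) be the cumulants of $v$, and for $1\le k\le m-2$ let $$P_k(x)=\sum_{p_1+2p_2+\dots+kp_k=k}\frac{1}{p_1!\cdots p_k!}\Big(\frac{\gamma_3}{3!}\Big)^{p_1}\cdots\Big(\frac{\gamma_{k+2}}{(k+2)!}\Big)^{p_k}x^{k+2(p_1+\dots+p_k)},$$ the sum running over all non-negative integers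 $p_1,\dots,p_k$ with $p_1+2p_2+\dots+kp_k=k$. Put $$u_m(t)=u_m(t,z)=e^{-t^2/2}\Big(1+\sum_{k=1}^{m-2}P_k(it)\,z^k\Big).$$ For real $\sigma\ge 2$ and integer $p\ge 0$ put $m'(\sigma)=\sigma-p$ and $m''(\sigma)=3(m-2)+\max\{\sigma+p,(\sigma-1)p\}$. Derivatives are taken in $t$, and $|t|^0=1$. (a) If $s\ge 3$, there is a function $\varepsilon(z)$, not depending on $t$ or $p$, with $\varepsilon(z)\to0$ as $z\to 0$, such that for all real $z$ with $0<|z|\le 1$, all real $t$ with $|t^3z|\le c^3$ and all $p=0,1,\dots,m$, $$\big|v_z^{(p)}(t)-u_m^{(p)}(t)\big|\le\big(|t|^{m'(s)}+|t|^{m''(s)}\big)\,e^{-t^2/2}\,|z|^{s-2}\,\varepsilon(z).$$ (b) If $s\ge 2$ and $v$ has $m+1$ continuous derivatives, there is a constant $A$, not depending on $z$, $t$ or $p$, such that for all real $z$ with $0<|z|\le1$, all real $t$ with $|t^3z|\le c^3$ and all $p=0,1,\dots,m$, $$\big|v_z^{(p)}(t)-u_m^{(p)}(t)\big|\le A\,\big(|t|^{m'(m+1)}+|t|^{m''(m+1)}\big)\,e^{-t^2/2}\,|z|^{m-1}.$$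 -/

import Mathlib

open Filter Topology Asymptotics

namespace Edgeworth

noncomputable section

/-- `y : ℝ → ℂ` is `s`-times differentiable on the real line, for a real number `s ≥ 0`:
with `m = ⌊s⌋`, it has continuous derivatives up to order `m`, and at every point `t₀`,
`y⁽ᵐ⁾(t) = y⁽ᵐ⁾(t₀) + o(|t - t₀|^(s - m))` as `t → t₀`. -/
def TimesDifferentiable (s : ℝ) (y : ℝ → ℂ) : Prop :=
  ContDiff ℝ (⌊s⌋₊ : ℕ) y ∧
    ∀ t₀ : ℝ, (fun t : ℝ => iteratedDeriv ⌊s⌋₊ y t - iteratedDeriv ⌊s⌋₊ y t₀)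
      =o[𝓝 t₀] (fun t : ℝ => |t - t₀| ^ (s - (⌊s⌋₊ : ℝ)))

/-- The continuous branch of `log v` on the real line which vanishes at the origin, for a `C¹`
function `v` with `v 0 = 1`, namely `t ↦ ∫₀ᵗ v'(u) / v(u) du`. It is meaningful at all `t` such
that `v` has no zeros between `0` and `t`; see `exp_logBranch` below. As long as `v` stays off
the negative half-axis it is the principal value of `log v`; see `logBranch_eq_log` below. -/
def logBranch (v : ℝ → ℂ) (t : ℝ) : ℂ := ∫ u in (0 : ℝ)..t, deriv v u / v u

/-- The generalized cumulants `γ_k = i^{-k} (d/dt)^k log v(t)` at `t = 0`. -/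
def cumulant (v : ℝ → ℂ) (k : ℕ) : ℂ := iteratedDeriv k (logBranch v) 0 / Complex.I ^ k

/-- The non-negative integer solutions `(p₁, …, p_k)` of `p₁ + 2 p₂ + ⋯ + k p_k = k`.
The entry `p_r` is `q j` with `r = j + 1`; every solution has all its entries at most `k`. -/
def weightedSolutions (k : ℕ) : Finset (Fin k → ℕ) :=
  (Fintype.piFinset fun _ : Fin k => Finset.range (k + 1)).filter
    fun q => ∑ j : Fin k, ((j : ℕ) + 1) * q j = k

/-- The polynomial
`P_k(x) = ∑ (1 / (p₁! ⋯ p_k!)) (γ₃ / 3!)^{p₁} ⋯ (γ_{k+2} / (k+2)!)^{p_k} x^{k + 2(p₁ + ⋯ + p_k)}`,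
the sum being over all solutions of `p₁ + 2 p₂ + ⋯ + k p_k = k`. -/
def edgeworthPoly (γ : ℕ → ℂ) (k : ℕ) (x : ℂ) : ℂ :=
  ∑ q ∈ weightedSolutions k,
    (∏ j : Fin k, (1 / ((q j).factorial : ℂ)) *
      (γ ((j : ℕ) + 3) / (((j : ℕ) + 3).factorial : ℂ)) ^ q j) *
    x ^ (k + 2 * ∑ j : Fin k, q j)

/-- `v_z(t) = v(tz)^{1/z²}`, the power being taken with the continuous branch of `log v`. -/
def powerFun (v : ℝ → ℂ) (z t : ℝ) : ℂ := Complex.exp (logBranch v (t * z) / (z : ℂ) ^ 2)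

/-- `u_m(t) = u_m(t, z) = e^{-t²/2} (1 + ∑_{k=1}^{m-2} P_k(it) z^k)`, where the polynomials `P_k`
are based on the cumulants of `v`. -/
def edgeworthApprox (v : ℝ → ℂ) (m : ℕ) (z t : ℝ) : ℂ :=
  Complex.exp (-(t : ℂ) ^ 2 / 2) *
    (1 + ∑ k ∈ Finset.Icc 1 (m - 2),
      edgeworthPoly (cumulant v) k (Complex.I * (t : ℂ)) * (z : ℂ) ^ k)

/-- The exponent `m' = s - p`. -/
def expLow (s : ℝ) (p : ℕ) : ℝ := s - p

/-- The exponent `m'' = 3(m - 2) + max {s + p, (s - 1) p}`. -/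
def expHigh (m : ℕ) (s : ℝ) (p : ℕ) : ℝ := 3 * ((m : ℝ) - 2) + max (s + p) ((s - 1) * p)

theorem hasDerivAt_logBranch {v : ℝ → ℂ} (hv : ContDiff ℝ 1 v) {t : ℝ}
    (hne : ∀ u ∈ Set.uIcc 0 t, v u ≠ 0) :
    HasDerivAt (logBranch v) (deriv v t / v t) t := by
  have hd : Continuous (deriv v) := hv.continuous_deriv le_rfl
  have ht : v t ≠ 0 := hne t Set.right_mem_uIcc
  refine intervalIntegral.integral_hasDerivAt_right ?_ ?_ ?_
  · exact (hd.continuousOn.div hv.continuous.continuousOn hne).intervalIntegrable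
  · exact (hd.measurable.div hv.continuous.measurable).stronglyMeasurable
      |>.stronglyMeasurableAtFilter
  · exact hd.continuousAt.div hv.continuous.continuousAt ht

theorem exp_logBranch {v : ℝ → ℂ} (hv : ContDiff ℝ 1 v) (h0 : v 0 = 1) {t : ℝ}
    (hne : ∀ u ∈ Set.uIcc 0 t, v u ≠ 0) : Complex.exp (logBranch v t) = v t := by
  have key : ∀ u ∈ Set.uIcc 0 t,
      HasDerivAt (fun r => Complex.exp (-logBranch v r) * v r) 0 u := by
    intro u hu
    have hsub : Set.uIcc 0 u ⊆ Set.uIcc 0 t := Set.uIcc_subset_uIcc_left hu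
    have h1 := (hasDerivAt_logBranch hv fun r hr => hne r (hsub hr)).neg.cexp
    have h2 := h1.mul (hv.differentiable one_ne_zero u).hasDerivAt
    refine h2.congr_deriv ?_
    have := hne u hu
    field_simp
    simp
  have hint := intervalIntegral.integral_eq_sub_of_hasDerivAt key (by simp)
  have hz : Complex.exp (-logBranch v t) * v t = 1 := by
    have h3 : logBranch v 0 = 0 := by simp [logBranch]
    simp only [intervalIntegral.integral_zero, h3, h0] at hint
    simp only [neg_zero, Complex.exp_zero, mul_one] at hint
    linear_combination -hint
  rw [Complex.exp_neg] at hz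
  field_simp at hz
  exact hz.symm

theorem logBranch_eq_log {v : ℝ → ℂ} (hv : ContDiff ℝ 1 v) (h0 : v 0 = 1) {t : ℝ}
    (hs : ∀ u ∈ Set.uIcc 0 t, v u ∈ Complex.slitPlane) :
    logBranch v t = Complex.log (v t) := by
  have hne : ∀ u ∈ Set.uIcc 0 t, v u ≠ 0 := fun u hu => Complex.slitPlane_ne_zero (hs u hu)
  have hd : Continuous (deriv v) := hv.continuous_deriv le_rfl
  have h := intervalIntegral.integral_eq_sub_of_hasDerivAt
    (f := fun u => Complex.log (v u)) (f' := fun u => deriv v u / v u) (a := 0) (b := t)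
    (fun u hu => (hv.differentiable one_ne_zero u).hasDerivAt.clog_real (hs u hu))
    (hd.continuousOn.div hv.continuous.continuousOn hne).intervalIntegrable
  simpa [logBranch, h0] using h

end

end Edgeworth

/-!
Write `L = logBranch v`, `m = ⌊s⌋ = n + 2`, and let `R` be the remainder of the Taylor expansion of
`L` of order `m` at the origin. As `L(0) = L'(0) = 0` and `L''(0) = -1`,

  `v_z(t) = e^{-t²/2} e^{Q(t)} e^{R(tz)/z²}`,  where `Q(t) = ∑_{j < n} a_j`,
  `a_j = γ_{j+3} (it)^{j+3} z^{j+1} / (j+3)!`,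

and the Edgeworth sum `S = 1 + ∑ P_k(it) z^k` consists of the terms of the product of the
exponential series of the `a_j` in which `z` has an exponent at most `n`
(`one_add_sum_edgeworthPoly`). So

  `v_z - u_m = e^{-t²/2} e^Q (e^{R(tz)/z²} - 1) + e^{-t²/2} (e^Q - S)`.

The functions `e^{-t²/2} e^Q` and `e^{-t²/2} (e^Q - S)` are entire in `t`, so their derivatives need
no computation: Cauchy's estimate on the circle of radius `1 / (|t| + 1/|t|)` about `t` reduces them
to bounds of the functions at complex points of modulus at most `2|t|`. In the region
`|t³ z| ≤ c³`, `|z| ≤ 1` all `a_j` are bounded there, and the neglected terms give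
`|e^Q - S| ≤ C |z|^{m-1} (|t|^{m+1} + |t|^{3(m-1)})` (`exists_norm_exp_sub_sum_expTerm_le`).

The factor `e^{R(tz)/z²} - 1` is only `m` times differentiable. A bound
`|R⁽ᵐ⁾(τ)| ≤ K |τ|^{σ-m}` integrates to `|R⁽ʲ⁾(τ)| ≤ K |τ|^{σ-j}`, so the `j`-th derivative of
`R(tz)/z²` is at most `K |z|^{σ-2} |t|^{σ-j}`, and the Leibniz rule carries this over to
`e^{R(tz)/z²} - 1` (`exists_norm_iteratedDeriv_exp_sub_one_le`). Together, the difference of the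
derivatives is bounded with the constant `C (K + |z|^{m+1-σ})`
(`exists_norm_iteratedDeriv_powerFun_sub_le`).

In (b), `σ = m + 1` and `K` is fixed. In (a), `σ = s < m + 1`; differentiating `v L' = v'` shows that
`L⁽ᵐ⁾` inherits the local condition on `v⁽ᵐ⁾`, and as `|tz| ≤ c |z|^{2/3}`, the constant `K` may be
taken arbitrarily small when `z` is small.
-/

namespace Edgeworth

/-! ### Iterated derivatives -/

theorem iteratedDeriv_comp_ofReal {H : ℂ → ℂ} (hH : Differentiable ℂ H) (n : ℕ) (t : ℝ) :
    iteratedDeriv n (fun x : ℝ => H x) t = iteratedDeriv n H t := by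
  induction n generalizing t with
  | zero => simp
  | succ n ih =>
    rw [iteratedDeriv_succ, iteratedDeriv_succ, funext ih]
    have hd : Differentiable ℂ (iteratedDeriv n H) :=
      (hH.contDiff (n := ⊤)).differentiable_iteratedDeriv n (by exact_mod_cast WithTop.coe_lt_top _)
    exact (hd t).hasDerivAt.comp_ofReal.deriv

theorem iteratedDeriv_comp_mul_left (f : ℝ → ℂ) (z : ℝ) (n : ℕ) (t : ℝ) :
    iteratedDeriv n (fun x => f (z * x)) t = z ^ n • iteratedDeriv n f (z * t) := by
  induction n generalizing t with
  | zero => simp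
  | succ n ih =>
    rw [iteratedDeriv_succ, funext ih, iteratedDeriv_succ, pow_succ, mul_smul,
      deriv_fun_const_smul_field, deriv_comp_mul_left]

theorem contDiffAt_iteratedDeriv {f : ℝ → ℂ} {x : ℝ} {k : ℕ} :
    ∀ (j : ℕ) {N : ℕ}, ContDiffAt ℝ N f x → k + j ≤ N → ContDiffAt ℝ k (iteratedDeriv j f) x := by
  intro j
  induction j generalizing k with
  | zero =>
    intro N h hk
    rw [iteratedDeriv_zero]
    exact h.of_le (by exact_mod_cast hk)
  | succ j ih =>
    intro N h hk
    rw [iteratedDeriv_succ]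
    have := ih (k := k + 1) h (by omega)
    exact this.derivWithin (m := k) (by push_cast; exact le_rfl)

/-- Cauchy's estimate for the restriction of an entire function to the real line. -/
theorem norm_iteratedDeriv_comp_ofReal_le {H : ℂ → ℂ} (hH : Differentiable ℂ H) {t M B : ℝ}
    (hM : 0 < M) (hB : ∀ ζ : ℂ, ‖ζ - t‖ = M⁻¹ → ‖H ζ‖ ≤ B) (n : ℕ) :
    ‖iteratedDeriv n (fun x : ℝ => H x) t‖ ≤ n.factorial * B * M ^ n := by
  rw [iteratedDeriv_comp_ofReal hH]
  have h := Complex.norm_iteratedDeriv_le_of_forall_mem_sphere_norm_le n (inv_pos.2 hM)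
    (hH.diffContOnCl (s := Metric.ball (t : ℂ) M⁻¹))
    (fun ζ hζ => hB ζ (by simpa [dist_eq_norm] using hζ))
  simpa [div_eq_mul_inv] using h

theorem norm_iteratedDeriv_mul_le {f g : ℝ → ℂ} {t M a b : ℝ} {n : ℕ}
    (hf : ContDiffAt ℝ n f t) (hg : ContDiffAt ℝ n g t)
    (hfa : ∀ j ≤ n, ‖iteratedDeriv j f t‖ ≤ a * M ^ j)
    (hgb : ∀ j ≤ n, ‖iteratedDeriv j g t‖ ≤ b * M ^ j) :
    ‖iteratedDeriv n (fun x => f x * g x) t‖ ≤ 2 ^ n * (a * b) * M ^ n := by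
  have h := iteratedDeriv_mul hf hg
  have h' : iteratedDeriv n (fun x => f x * g x) t = _ := h
  rw [h']
  refine (norm_sum_le _ _).trans ?_
  have hterm : ∀ i ∈ Finset.range (n + 1),
      ‖(n.choose i : ℂ) * iteratedDeriv i f t * iteratedDeriv (n - i) g t‖
        ≤ (n.choose i : ℝ) * (a * b * M ^ n) := by
    intro i hi
    have hi' : i ≤ n := Nat.lt_succ_iff.1 (Finset.mem_range.1 hi)
    rw [norm_mul, norm_mul, Complex.norm_natCast, mul_assoc]
    refine mul_le_mul_of_nonneg_left ?_ (by positivity)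
    calc ‖iteratedDeriv i f t‖ * ‖iteratedDeriv (n - i) g t‖
        ≤ (a * M ^ i) * (b * M ^ (n - i)) :=
          mul_le_mul (hfa i hi') (hgb _ (Nat.sub_le _ _)) (norm_nonneg _)
            ((norm_nonneg _).trans (hfa i hi'))
      _ = a * b * (M ^ i * M ^ (n - i)) := by ring
      _ = a * b * M ^ n := by rw [← pow_add, Nat.add_sub_cancel' hi']
  refine (Finset.sum_le_sum hterm).trans_eq ?_
  rw [← Finset.sum_mul, ← Nat.cast_sum, Nat.sum_range_choose]
  push_cast
  ring

/-- Both bounds for `e^f` come from applying the Leibniz rule to `(e^f)' = f' e^f`; the factor `ω`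
is kept for derivatives of positive order. -/
theorem exists_norm_iteratedDeriv_exp_le (n : ℕ) (B : ℝ) :
    ∃ C : ℝ, 0 ≤ C ∧ ∀ (f : ℝ → ℂ) (t M ω : ℝ), ContDiffAt ℝ n f t → 0 ≤ M → ω ≤ B →
      (∀ j ≤ n, ‖iteratedDeriv j f t‖ ≤ ω * M ^ j) → ∀ j ≤ n,
        ‖iteratedDeriv j (fun x => Complex.exp (f x)) t‖ ≤ C * M ^ j ∧
        (1 ≤ j → ‖iteratedDeriv j (fun x => Complex.exp (f x)) t‖ ≤ C * ω * M ^ j) := by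
  induction n with
  | zero =>
    refine ⟨Real.exp B, (Real.exp_pos _).le, fun f t M ω _ _ hω hf j hj => ?_⟩
    obtain rfl : j = 0 := by omega
    have h0 := hf 0 le_rfl
    simp only [iteratedDeriv_zero, pow_zero, mul_one] at h0 ⊢
    exact ⟨(Complex.norm_exp_le_exp_norm _).trans (Real.exp_le_exp.2 (h0.trans hω)), by simp⟩
  | succ n ih =>
    obtain ⟨C, hC, h⟩ := ih
    refine ⟨C + 2 ^ n * C + 2 ^ n * C * |B|, by positivity, fun f t M ω hfc hM hω hf j hj => ?_⟩
    have hω0 : 0 ≤ ω := by simpa using (norm_nonneg _).trans (hf 0 (Nat.zero_le _))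
    have hωB : ω ≤ |B| := hω.trans (le_abs_self B)
    have hfn : ContDiffAt ℝ n f t := hfc.of_le (by exact_mod_cast Nat.le_succ n)
    have hn := h f t M ω hfn hM hω (fun j hj => hf j (by omega))
    rcases Nat.lt_or_ge n j with hjn | hjn
    · obtain rfl : j = n + 1 := by omega
      have hev : deriv (fun x => Complex.exp (f x)) =ᶠ[𝓝 t]
          fun x => deriv f x * Complex.exp (f x) := by
        have hd : ∀ᶠ x in 𝓝 t, ContDiffAt ℝ (n + 1 : ℕ) f x := hfc.eventually (by simp)
        filter_upwards [hd] with x hx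
        have := (hx.differentiableAt (by simp)).hasDerivAt.cexp.deriv
        rw [this, mul_comm]
      have hfd : ContDiffAt ℝ n (deriv f) t :=
        iteratedDeriv_one (f := f) ▸ contDiffAt_iteratedDeriv 1 hfc le_rfl
      have hmain : ‖iteratedDeriv (n + 1) (fun x => Complex.exp (f x)) t‖
          ≤ 2 ^ n * (ω * M * C) * M ^ n := by
        rw [iteratedDeriv_succ', hev.iteratedDeriv_eq]
        refine norm_iteratedDeriv_mul_le hfd hfn.cexp (fun j hj => ?_) fun j hj => (hn j hj).1
        rw [← iteratedDeriv_succ', mul_assoc, ← pow_succ']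
        exact hf (j + 1) (by omega)
      have hMn : 0 ≤ M ^ (n + 1) := by positivity
      have e : 2 ^ n * (ω * M * C) * M ^ n = (2 ^ n * C) * ω * M ^ (n + 1) := by ring
      rw [e] at hmain
      refine ⟨hmain.trans ?_, fun _ => hmain.trans ?_⟩
      · refine mul_le_mul_of_nonneg_right ?_ hMn
        have : 2 ^ n * C * ω ≤ 2 ^ n * C * |B| := by gcongr
        have : 0 ≤ 2 ^ n * C := by positivity
        linarith
      · refine mul_le_mul_of_nonneg_right (mul_le_mul_of_nonneg_right ?_ hω0) hMn
        have : 0 ≤ 2 ^ n * C * |B| := by positivity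
        linarith
    · have hMj : 0 ≤ M ^ j := by positivity
      have hCC : C ≤ C + 2 ^ n * C + 2 ^ n * C * |B| := by
        have : 0 ≤ 2 ^ n * C := by positivity
        have : 0 ≤ 2 ^ n * C * |B| := by positivity
        linarith
      exact ⟨(hn j hjn).1.trans (by gcongr), fun h1 => ((hn j hjn).2 h1).trans (by gcongr)⟩

theorem exists_norm_iteratedDeriv_exp_sub_one_le (n : ℕ) (B : ℝ) :
    ∃ C : ℝ, 0 ≤ C ∧ ∀ (f : ℝ → ℂ) (t M ω : ℝ), ContDiffAt ℝ n f t → 0 ≤ M → ω ≤ B →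
      (∀ j ≤ n, ‖iteratedDeriv j f t‖ ≤ ω * M ^ j) → ∀ j ≤ n,
        ‖iteratedDeriv j (fun x => Complex.exp (f x) - 1) t‖ ≤ C * ω * M ^ j := by
  obtain ⟨C, hC, h⟩ := exists_norm_iteratedDeriv_exp_le n B
  refine ⟨C + Real.exp B, by positivity, fun f t M ω hfc hM hω hf j hj => ?_⟩
  have hω0 : 0 ≤ ω := by simpa using (norm_nonneg _).trans (hf 0 (Nat.zero_le _))
  have hMj : 0 ≤ M ^ j := by positivity
  rcases Nat.eq_zero_or_pos j with rfl | hj0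
  · have h0 := hf 0 (Nat.zero_le _)
    simp only [iteratedDeriv_zero, pow_zero, mul_one] at h0 ⊢
    have := Complex.norm_exp_sub_sum_le_norm_mul_exp (f t) 1
    simp only [Finset.range_one, Finset.sum_singleton, pow_zero, Nat.factorial_zero, Nat.cast_one,
      div_one, pow_one] at this
    calc _ ≤ _ := this
      _ ≤ ω * Real.exp B :=
        mul_le_mul h0 (Real.exp_le_exp.2 (h0.trans hω)) (Real.exp_pos _).le hω0
      _ ≤ (C + Real.exp B) * ω := by nlinarith [mul_nonneg hC hω0]
  · have e : iteratedDeriv j (fun x => Complex.exp (f x) - 1) t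
        = iteratedDeriv j (fun x => Complex.exp (f x)) t := by
      obtain ⟨k, rfl⟩ : ∃ k, j = k + 1 := ⟨j - 1, by omega⟩
      rw [iteratedDeriv_succ', iteratedDeriv_succ']
      congr 1
      funext x
      exact deriv_sub_const _
    rw [e]
    refine ((h f t M ω hfc hM hω hf j hj).2 hj0).trans ?_
    have := Real.exp_pos B
    gcongr
    linarith

/-- If the derivatives of `R` at `0` of order below `m` vanish, a bound `K |x|^α` on the `m`-th
derivative integrates to `K |x|^(α + m - j)` for the `j`-th one. -/
theorem norm_iteratedDeriv_le_of_norm_iteratedDeriv_le {R : ℝ → ℂ} {m : ℕ} {δ K α : ℝ}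
    (hα : 0 ≤ α) (hK : 0 ≤ K) (hR : ∀ x, |x| ≤ δ → ContDiffAt ℝ m R x)
    (h0 : ∀ j < m, iteratedDeriv j R 0 = 0)
    (hm : ∀ x, |x| ≤ δ → ‖iteratedDeriv m R x‖ ≤ K * |x| ^ α) (i : ℕ) :
    ∀ j, j + i = m → ∀ x, |x| ≤ δ → ‖iteratedDeriv j R x‖ ≤ K * |x| ^ (α + i) := by
  induction i with
  | zero => rintro j rfl x hx; simpa using hm x hx
  | succ i ih =>
    rintro j hj x hx
    have hb : ∀ y ∈ Set.uIcc 0 x, |y| ≤ |x| := fun y hy => by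
      simpa using Set.abs_sub_left_of_mem_uIcc hy
    have hder : ∀ y ∈ Set.uIcc 0 x, DifferentiableAt ℝ (iteratedDeriv j R) y := fun y hy => by
      exact (contDiffAt_iteratedDeriv (k := 1) j (hR y ((hb y hy).trans hx))
        (by omega)).differentiableAt (by simp)
    have hbd : ∀ y ∈ Set.uIcc 0 x, ‖deriv (iteratedDeriv j R) y‖ ≤ K * |x| ^ (α + i) := by
      intro y hy
      rw [← iteratedDeriv_succ]
      refine (ih (j + 1) (by omega) y ((hb y hy).trans hx)).trans ?_
      have := hb y hy
      gcongr
    have := (convex_uIcc (0 : ℝ) x).norm_image_sub_le_of_norm_deriv_le hder hbd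
      Set.left_mem_uIcc Set.right_mem_uIcc
    rw [h0 j (by omega), sub_zero, sub_zero, Real.norm_eq_abs] at this
    refine this.trans_eq ?_
    rw [mul_assoc]
    congr 1
    push_cast
    rw [← add_assoc]
    rcases eq_or_ne x 0 with rfl | hx0
    · rw [abs_zero, mul_zero, Real.zero_rpow (by positivity)]
    · rw [Real.rpow_add_one (abs_ne_zero.2 hx0)]

/-! ### The Edgeworth polynomials as part of a product of exponential series -/

/-- The weight `p₁ + 2 p₂ + ⋯ + n pₙ` of a tuple of exponents, where `p_r` is `q j` for
`r = j + 1`. -/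
def weight {n : ℕ} (q : Fin n → ℕ) : ℕ := ∑ j : Fin n, ((j : ℕ) + 1) * q j

/-- The term `∏ⱼ aⱼ^{qⱼ} / qⱼ!` of the expansion of `exp (a₀ + ⋯ + a_{n-1})` as a product of
exponential series. -/
noncomputable def expTerm (a : ℕ → ℂ) {n : ℕ} (q : Fin n → ℕ) : ℂ :=
  ∏ j : Fin n, a j ^ q j / ((q j).factorial : ℂ)

/-- The tuples of exponents at most `n`. -/
def exponentBox (n : ℕ) : Finset (Fin n → ℕ) :=
  Fintype.piFinset fun _ : Fin n => Finset.range (n + 1)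

theorem mem_weightedSolutions {k : ℕ} {q : Fin k → ℕ} :
    q ∈ weightedSolutions k ↔ weight q = k := by
  rw [weightedSolutions, Finset.mem_filter, Fintype.mem_piFinset, weight]
  refine ⟨fun h => h.2, fun h => ⟨fun j => ?_, h⟩⟩
  have h1 : ((j : ℕ) + 1) * q j ≤ ∑ j : Fin k, ((j : ℕ) + 1) * q j :=
    Finset.single_le_sum (f := fun j : Fin k => ((j : ℕ) + 1) * q j)
      (fun _ _ => Nat.zero_le _) (Finset.mem_univ j)
  rw [Finset.mem_range]
  nlinarith

/-- The term `γ_{j+3} (iζ)^{j+3} z^{j+1} / (j+3)!`: for `ζ = t`, these are the terms of the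
logarithm of `e^{t²/2} v_z(t)`, up to the Taylor remainder of `log v`. -/
noncomputable def logTerm (γ : ℕ → ℂ) (z : ℝ) (ζ : ℂ) (j : ℕ) : ℂ :=
  γ (j + 3) / ((j + 3).factorial : ℂ) * (Complex.I * ζ) ^ (j + 3) * (z : ℂ) ^ (j + 1)

theorem edgeworthPoly_mul_pow (γ : ℕ → ℂ) (k : ℕ) (z : ℝ) (ζ : ℂ) :
    edgeworthPoly γ k (Complex.I * ζ) * (z : ℂ) ^ k
      = ∑ q ∈ weightedSolutions k, expTerm (logTerm γ z ζ) q := by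
  rw [edgeworthPoly, Finset.sum_mul]
  refine Finset.sum_congr rfl fun q hq => ?_
  have hw := mem_weightedSolutions.1 hq
  have h3 : k + 2 * ∑ j : Fin k, q j = ∑ j : Fin k, ((j : ℕ) + 3) * q j := by
    nth_rewrite 1 [← hw]
    rw [weight, Finset.mul_sum, ← Finset.sum_add_distrib]
    exact Finset.sum_congr rfl fun j _ => by ring
  have hz : (z : ℂ) ^ k = (z : ℂ) ^ ∑ j : Fin k, ((j : ℕ) + 1) * q j := by
    rw [← weight, hw]
  rw [h3, hz, ← Finset.prod_pow_eq_pow_sum, ← Finset.prod_pow_eq_pow_sum,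
    ← Finset.prod_mul_distrib, ← Finset.prod_mul_distrib, expTerm]
  refine Finset.prod_congr rfl fun j _ => ?_
  rw [logTerm, pow_mul, pow_mul, mul_pow, mul_pow]
  ring

theorem weight_eq_sum_range {n : ℕ} (q : ℕ → ℕ) :
    weight (fun j : Fin n => q j) = ∑ j ∈ Finset.range n, (j + 1) * q j :=
  Fin.sum_univ_eq_sum_range (fun j => (j + 1) * q j) n

theorem expTerm_eq_prod_range {n : ℕ} (a : ℕ → ℂ) (q : ℕ → ℕ) :
    expTerm a (fun j : Fin n => q j)
      = ∏ j ∈ Finset.range n, a j ^ q j / ((q j).factorial : ℂ) :=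
  Fin.prod_univ_eq_prod_range (fun j => a j ^ q j / ((q j).factorial : ℂ)) n

/-- A tuple of weight `k` has no entries of index `k` or more, so the solutions of
`p₁ + 2 p₂ + ⋯ + k p_k = k` may be padded with zeros. -/
theorem sum_weightedSolutions_eq {k n : ℕ} (hk : k ≤ n) (a : ℕ → ℂ) :
    ∑ q ∈ weightedSolutions k, expTerm a q
      = ∑ q ∈ exponentBox n with weight q = k, expTerm a q := by
  -- padding by zeros to a sequence
  let e : ∀ {l : ℕ}, (Fin l → ℕ) → ℕ → ℕ := fun {l} q j => if h : j < l then q ⟨j, h⟩ else 0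
  have he : ∀ {l : ℕ} (q : Fin l → ℕ), (fun j : Fin l => e q j) = q := by
    intro l q; funext j; simp [e]
  have hsub : Finset.range k ⊆ Finset.range n := Finset.range_subset_range.2 hk
  have hvan : ∀ q : ℕ → ℕ, (∑ j ∈ Finset.range n, (j + 1) * q j) = k →
      ∀ j ∈ Finset.range n, j ∉ Finset.range k → q j = 0 := by
    intro q hq j hj hjk
    have h1 : (j + 1) * q j ≤ ∑ j ∈ Finset.range n, (j + 1) * q j :=
      Finset.single_le_sum (f := fun j => (j + 1) * q j) (fun _ _ => Nat.zero_le _) hj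
    rw [Finset.mem_range, not_lt] at hjk
    by_contra h0
    have : 1 ≤ q j := Nat.one_le_iff_ne_zero.2 h0
    nlinarith
  have hpad : ∀ q : Fin k → ℕ, ∀ j ∈ Finset.range n, j ∉ Finset.range k → e q j = 0 := by
    intro q j _ hj
    simp only [e, Finset.mem_range] at hj ⊢
    rw [dif_neg hj]
  refine Finset.sum_bij' (fun q _ => fun j : Fin n => e q j) (fun q _ => fun j : Fin k => e q j)
    ?_ ?_ ?_ ?_ ?_
  · intro q hq
    have hw := mem_weightedSolutions.1 hq
    have hw' : weight (fun j : Fin n => e q j) = k := by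
      rw [weight_eq_sum_range, ← Finset.sum_subset hsub fun j hj hjk => by
        rw [hpad q j hj hjk, mul_zero], ← weight_eq_sum_range, he, hw]
    refine Finset.mem_filter.2 ⟨Fintype.mem_piFinset.2 fun j => ?_, hw'⟩
    have h1 : ((j : ℕ) + 1) * e q j ≤ weight (fun j : Fin n => e q j) :=
      Finset.single_le_sum (f := fun j : Fin n => ((j : ℕ) + 1) * e q j)
        (fun _ _ => Nat.zero_le _) (Finset.mem_univ j)
    rw [Finset.mem_range]
    nlinarith
  · intro q hq
    have hw := (Finset.mem_filter.1 hq).2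
    rw [← he q, weight_eq_sum_range] at hw
    rw [mem_weightedSolutions, weight_eq_sum_range,
      Finset.sum_subset hsub fun j hj hjk => by rw [hvan _ hw j hj hjk, mul_zero], hw]
  · intro q hq
    funext j
    have : (j : ℕ) < n := j.2.trans_le hk
    simp [e, this]
  · intro q hq
    have hw := (Finset.mem_filter.1 hq).2
    rw [← he q, weight_eq_sum_range] at hw
    funext j
    by_cases hj : (j : ℕ) < k
    · simp [e, hj]
    · have := hvan _ hw j (Finset.mem_range.2 j.2) (by simpa using hj)
      simp only [e, hj, dite_false]
      simpa [e] using this.symm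
  · intro q hq
    rw [expTerm_eq_prod_range, ← Finset.prod_subset hsub fun j hj hjk => by simp [hpad q j hj hjk],
      ← expTerm_eq_prod_range, he]

/-- The Edgeworth sum consists of the terms of weight at most `n` of the expansion of
`exp (∑ⱼ logTerm γ z ζ j)`. -/
theorem one_add_sum_edgeworthPoly (γ : ℕ → ℂ) (n : ℕ) (z : ℝ) (ζ : ℂ) :
    1 + ∑ k ∈ Finset.Icc 1 n, edgeworthPoly γ k (Complex.I * ζ) * (z : ℂ) ^ k
      = ∑ q ∈ exponentBox n with weight q ≤ n, expTerm (logTerm γ z ζ) q := by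
  have h0 : edgeworthPoly γ 0 (Complex.I * ζ) * (z : ℂ) ^ 0 = 1 := by
    rw [edgeworthPoly_mul_pow]
    have : weightedSolutions 0 = {default} := by
      ext q
      simp [mem_weightedSolutions, weight, Subsingleton.elim q default]
    rw [this, Finset.sum_singleton]
    simp [expTerm]
  have hr : Finset.range (n + 1) = insert 0 (Finset.Icc 1 n) := by
    ext j; simp only [Finset.mem_range, Finset.mem_insert, Finset.mem_Icc]; omega
  have hs : 1 + ∑ k ∈ Finset.Icc 1 n, edgeworthPoly γ k (Complex.I * ζ) * (z : ℂ) ^ k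
      = ∑ k ∈ Finset.range (n + 1), edgeworthPoly γ k (Complex.I * ζ) * (z : ℂ) ^ k := by
    rw [hr, Finset.sum_insert (by simp), h0]
  rw [hs, ← Finset.sum_fiberwise_of_maps_to (g := weight) (t := Finset.range (n + 1))
    (fun q hq => by
      have := (Finset.mem_filter.1 hq).2
      exact Finset.mem_range.2 (Nat.lt_succ_iff.2 this))]
  refine Finset.sum_congr rfl fun k hk => ?_
  have hk' : k ≤ n := Nat.lt_succ_iff.1 (Finset.mem_range.1 hk)
  rw [edgeworthPoly_mul_pow, sum_weightedSolutions_eq hk', Finset.filter_filter]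
  refine Finset.sum_congr (Finset.filter_congr fun q _ => ?_) fun _ _ => rfl
  exact ⟨fun h => ⟨h.le.trans hk', h⟩, fun h => h.2⟩

theorem norm_prod_sub_prod_le {ι : Type*} (s : Finset ι) (f g : ι → ℂ) {D δ : ℝ} (hD : 1 ≤ D)
    (hf : ∀ i ∈ s, ‖f i‖ ≤ D) (hg : ∀ i ∈ s, ‖g i‖ ≤ D) (hfg : ∀ i ∈ s, ‖f i - g i‖ ≤ δ) :
    ‖∏ i ∈ s, f i - ∏ i ∈ s, g i‖ ≤ s.card * D ^ s.card * δ := by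
  classical
  induction s using Finset.induction_on with
  | empty => simp
  | insert i s hi ih =>
    have ih' := ih (fun j hj => hf j (Finset.mem_insert_of_mem hj))
      (fun j hj => hg j (Finset.mem_insert_of_mem hj))
      (fun j hj => hfg j (Finset.mem_insert_of_mem hj))
    have h1 := hfg i (Finset.mem_insert_self i s)
    have hδ : 0 ≤ δ := (norm_nonneg _).trans h1
    have hfi := hf i (Finset.mem_insert_self i s)
    have hgs : ‖∏ j ∈ s, g j‖ ≤ D ^ s.card := by
      rw [norm_prod]
      exact (Finset.prod_le_prod (fun _ _ => norm_nonneg _)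
        fun j hj => hg j (Finset.mem_insert_of_mem hj)).trans_eq (by simp)
    rw [Finset.prod_insert hi, Finset.prod_insert hi, Finset.card_insert_of_notMem hi]
    have e : f i * ∏ j ∈ s, f j - g i * ∏ j ∈ s, g j
        = f i * (∏ j ∈ s, f j - ∏ j ∈ s, g j) + (f i - g i) * ∏ j ∈ s, g j := by ring
    rw [e]
    refine (norm_add_le _ _).trans ?_
    rw [norm_mul, norm_mul]
    have hD0 : 0 ≤ D := by linarith
    calc _ ≤ D * (s.card * D ^ s.card * δ) + δ * D ^ s.card := by gcongr
      _ ≤ D * (s.card * D ^ s.card * δ) + δ * D ^ (s.card + 1) := by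
        gcongr 2
        exact pow_le_pow_right₀ hD (by omega)
      _ = _ := by push_cast; ring

/-- With `x = |ζ|` and `y = |z|`, this bounds the terms of weight `k > n`: such a term is a
monomial in which `ζ` has an exponent `N = k + 2r` with `1 ≤ r ≤ k`. -/
theorem pow_mul_pow_le_of_weight {n k N : ℕ} {x y B : ℝ} (hx : 0 ≤ x) (hy : 0 ≤ y) (hy1 : y ≤ 1)
    (hB : 1 ≤ B) (hxy : x ^ 3 * y ≤ B) (hk : n + 1 ≤ k) (hN : k + 2 ≤ N) (hN' : N ≤ 3 * k) :
    x ^ N * y ^ k ≤ B ^ k * (y ^ (n + 1) * (x ^ (n + 3) + x ^ (3 * (n + 1)))) := by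
  have hB0 : 0 ≤ B := by linarith
  rcases le_total x 1 with h | h
  · calc x ^ N * y ^ k ≤ x ^ (n + 3) * y ^ (n + 1) :=
          mul_le_mul (pow_le_pow_of_le_one hx h (by omega)) (pow_le_pow_of_le_one hy hy1 hk)
            (by positivity) (by positivity)
      _ ≤ y ^ (n + 1) * (x ^ (n + 3) + x ^ (3 * (n + 1))) := by
          have : 0 ≤ y ^ (n + 1) * x ^ (3 * (n + 1)) := by positivity
          linarith
      _ ≤ _ := le_mul_of_one_le_left (by positivity) (one_le_pow₀ hB)
  · obtain ⟨l, rfl⟩ : ∃ l, k = n + 1 + l := ⟨k - (n + 1), by omega⟩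
    calc x ^ N * y ^ (n + 1 + l) ≤ x ^ (3 * (n + 1 + l)) * y ^ (n + 1 + l) := by gcongr
      _ = (x ^ 3 * y) ^ l * (y ^ (n + 1) * x ^ (3 * (n + 1))) := by ring
      _ ≤ B ^ (n + 1 + l) * (y ^ (n + 1) * (x ^ (n + 3) + x ^ (3 * (n + 1)))) := by
        have h1 : (x ^ 3 * y) ^ l ≤ B ^ (n + 1 + l) :=
          (pow_le_pow_left₀ (by positivity) hxy l).trans (pow_le_pow_right₀ hB (by omega))
        have h2 : 0 ≤ x ^ (n + 3) := by positivity
        gcongr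
        linarith

theorem norm_logTerm (γ : ℕ → ℂ) (z : ℝ) (ζ : ℂ) (j : ℕ) :
    ‖logTerm γ z ζ j‖ = ‖γ (j + 3) / ((j + 3).factorial : ℂ)‖ * ‖ζ‖ ^ (j + 3) * |z| ^ (j + 1) := by
  simp [logTerm]

theorem exists_norm_logTerm_le (γ : ℕ → ℂ) (n : ℕ) {B : ℝ} (hB : 1 ≤ B) :
    ∃ A : ℝ, 0 ≤ A ∧ ∀ (ζ : ℂ) (z : ℝ), ‖ζ‖ * |z| ≤ B → ∀ j < n,
      ‖logTerm γ z ζ j‖ ≤ A * (‖ζ‖ ^ 3 * |z|) := by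
  refine ⟨(∑ j ∈ Finset.range n, ‖γ (j + 3) / ((j + 3).factorial : ℂ)‖) * B ^ n,
    by positivity, fun ζ z h j hj => ?_⟩
  rw [norm_logTerm]
  have h1 : ‖γ (j + 3) / ((j + 3).factorial : ℂ)‖
      ≤ ∑ j ∈ Finset.range n, ‖γ (j + 3) / ((j + 3).factorial : ℂ)‖ :=
    Finset.single_le_sum (f := fun j => ‖γ (j + 3) / ((j + 3).factorial : ℂ)‖)
      (fun _ _ => norm_nonneg _) (Finset.mem_range.2 hj)
  have h2 : (‖ζ‖ * |z|) ^ j ≤ B ^ n :=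
    (pow_le_pow_left₀ (by positivity) h j).trans (pow_le_pow_right₀ hB hj.le)
  calc _ = ‖γ (j + 3) / ((j + 3).factorial : ℂ)‖ * (‖ζ‖ * |z|) ^ j * (‖ζ‖ ^ 3 * |z|) := by ring
    _ ≤ _ := by gcongr

/-- The error made in `exp (∑ⱼ logTerm γ z ζ j)` by keeping the terms of weight at most `n`. It
consists of the error of truncating each exponential series, and of finitely many monomials. -/
theorem exists_norm_exp_sub_sum_expTerm_le (γ : ℕ → ℂ) (n : ℕ) {B : ℝ} (hB : 1 ≤ B) :
    ∃ C : ℝ, 0 ≤ C ∧ ∀ (ζ : ℂ) (z : ℝ), |z| ≤ 1 → ‖ζ‖ * |z| ≤ B → ‖ζ‖ ^ 3 * |z| ≤ B →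
      ‖Complex.exp (∑ j : Fin n, logTerm γ z ζ j)‖ ≤ C ∧
      ‖Complex.exp (∑ j : Fin n, logTerm γ z ζ j)
          - ∑ q ∈ exponentBox n with weight q ≤ n, expTerm (logTerm γ z ζ) q‖
        ≤ C * (|z| ^ (n + 1) * (‖ζ‖ ^ (n + 3) + ‖ζ‖ ^ (3 * (n + 1)))) := by
  obtain ⟨A, hA, hlog⟩ := exists_norm_logTerm_le γ n hB
  have hB0 : 0 ≤ B := by linarith
  set D := Real.exp (A * B) with hDdef
  have hD1 : 1 ≤ D := Real.one_le_exp (by positivity)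
  set C₁ : ℝ := n * D ^ n * (A ^ (n + 1) * D * B ^ (n + 1)) with hC₁
  set C₂ : ℝ := ∑ q ∈ exponentBox n with ¬ weight q ≤ n,
    (∏ j : Fin n, ‖γ (j + 3) / (((j : ℕ) + 3).factorial : ℂ)‖ ^ q j) * B ^ weight q with hC₂
  have hC₁0 : 0 ≤ C₁ := by positivity
  have hC₂0 : 0 ≤ C₂ := by positivity
  refine ⟨D ^ n + C₁ + C₂, by positivity, fun ζ z hz h1 h3 => ?_⟩
  set a := logTerm γ z ζ with ha
  have haB : ∀ j : Fin n, ‖a j‖ ≤ A * B := fun j =>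
    (hlog ζ z h1 j j.2).trans (mul_le_mul_of_nonneg_left h3 hA)
  have hexp : ∀ j : Fin n, ‖Complex.exp (a j)‖ ≤ D := fun j =>
    (Complex.norm_exp_le_exp_norm _).trans (Real.exp_le_exp.2 (haB j))
  let T : Fin n → ℂ := fun j => ∑ p ∈ Finset.range (n + 1), a j ^ p / (p.factorial : ℂ)
  have hT : ∀ j : Fin n, ‖T j‖ ≤ D := fun j => by
    refine (norm_sum_le _ _).trans (le_trans (le_of_eq ?_)
      ((Real.sum_le_exp_of_nonneg (norm_nonneg (a j)) (n + 1)).trans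
        (Real.exp_le_exp.2 (haB j))))
    exact Finset.sum_congr rfl fun p _ => by simp
  have hET : ∀ j : Fin n, ‖Complex.exp (a j) - T j‖
      ≤ A ^ (n + 1) * D * (|z| ^ (n + 1) * ‖ζ‖ ^ (3 * (n + 1))) := fun j => by
    refine (Complex.norm_exp_sub_sum_le_norm_mul_exp (a j) (n + 1)).trans ?_
    calc _ ≤ (A * (‖ζ‖ ^ 3 * |z|)) ^ (n + 1) * D := by
          have := hlog ζ z h1 j j.2
          have := Real.exp_le_exp.2 (haB j)
          gcongr
      _ = _ := by ring
  have hprodT : ∏ j : Fin n, T j = ∑ q ∈ exponentBox n, expTerm a q :=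
    Finset.prod_univ_sum _ _
  have hprodE : Complex.exp (∑ j : Fin n, a j) = ∏ j : Fin n, Complex.exp (a j) :=
    Complex.exp_sum _ _
  set E := |z| ^ (n + 1) * (‖ζ‖ ^ (n + 3) + ‖ζ‖ ^ (3 * (n + 1))) with hE
  have hE0 : 0 ≤ E := by positivity
  have part1 : ‖∏ j : Fin n, Complex.exp (a j) - ∏ j : Fin n, T j‖ ≤ C₁ * E := by
    refine (norm_prod_sub_prod_le Finset.univ _ _ hD1 (fun j _ => hexp j) (fun j _ => hT j)
      (fun j _ => hET j)).trans ?_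
    rw [Finset.card_univ, Fintype.card_fin, hC₁]
    have : |z| ^ (n + 1) * ‖ζ‖ ^ (3 * (n + 1)) ≤ B ^ (n + 1) * E := by
      have h4 : |z| ^ (n + 1) * ‖ζ‖ ^ (3 * (n + 1)) ≤ E := by
        have : 0 ≤ |z| ^ (n + 1) * ‖ζ‖ ^ (n + 3) := by positivity
        rw [hE]; linarith
      exact h4.trans (le_mul_of_one_le_left hE0 (one_le_pow₀ hB))
    calc _ ≤ n * D ^ n * (A ^ (n + 1) * D * (B ^ (n + 1) * E)) := by gcongr
      _ = _ := by ring
  have part2 : ‖∑ q ∈ exponentBox n with ¬ weight q ≤ n, expTerm a q‖ ≤ C₂ * E := by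
    rw [hC₂, Finset.sum_mul]
    refine norm_sum_le_of_le _ fun q hq => ?_
    have hw : n + 1 ≤ weight q := by
      have := (Finset.mem_filter.1 hq).2
      omega
    have e1 : ‖expTerm a q‖ ≤ (∏ j : Fin n, ‖γ (j + 3) / (((j : ℕ) + 3).factorial : ℂ)‖ ^ q j)
        * (‖ζ‖ ^ (∑ j : Fin n, ((j : ℕ) + 3) * q j) * |z| ^ weight q) := by
      rw [weight, ← Finset.prod_pow_eq_pow_sum, ← Finset.prod_pow_eq_pow_sum,
        ← Finset.prod_mul_distrib, ← Finset.prod_mul_distrib, expTerm, norm_prod]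
      refine Finset.prod_le_prod (fun _ _ => norm_nonneg _) fun j _ => ?_
      rw [norm_div, norm_pow, ha, norm_logTerm, Complex.norm_natCast, mul_pow, mul_pow, pow_mul,
        pow_mul, mul_assoc]
      exact div_le_self (by positivity) (by exact_mod_cast (q j).factorial_pos)
    refine e1.trans ?_
    rw [mul_assoc]
    refine mul_le_mul_of_nonneg_left ?_ (by positivity)
    have hsum : ∑ j : Fin n, ((j : ℕ) + 3) * q j = weight q + 2 * ∑ j : Fin n, q j := by
      rw [weight, Finset.mul_sum, ← Finset.sum_add_distrib]
      exact Finset.sum_congr rfl fun j _ => by ring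
    have hle : ∑ j : Fin n, q j ≤ weight q :=
      Finset.sum_le_sum fun j _ => Nat.le_mul_of_pos_left _ (Nat.succ_pos _)
    have hpos : 1 ≤ ∑ j : Fin n, q j := by
      by_contra h0
      have h0' : ∑ j : Fin n, q j = 0 := by omega
      have : weight q = 0 := Finset.sum_eq_zero fun j hj => by
        rw [Finset.sum_eq_zero_iff.1 h0' j hj, mul_zero]
      omega
    exact pow_mul_pow_le_of_weight (norm_nonneg _) (abs_nonneg _) hz hB h3 hw (by omega) (by omega)
  constructor
  · rw [hprodE, norm_prod]
    refine (Finset.prod_le_prod (fun _ _ => norm_nonneg _) fun j _ => hexp j).trans ?_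
    rw [Finset.prod_const, Finset.card_univ, Fintype.card_fin]
    linarith
  · have hsplit := Finset.sum_filter_add_sum_filter_not (exponentBox n)
      (fun q => weight q ≤ n) (expTerm a)
    have e : Complex.exp (∑ j : Fin n, a j) - ∑ q ∈ exponentBox n with weight q ≤ n, expTerm a q
        = (∏ j : Fin n, Complex.exp (a j) - ∏ j : Fin n, T j)
          + ∑ q ∈ exponentBox n with ¬ weight q ≤ n, expTerm a q := by
      rw [hprodE, hprodT, ← hsplit]; ring
    rw [e]
    refine (norm_add_le _ _).trans ((add_le_add part1 part2).trans ?_)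
    have : 0 ≤ D ^ n * E := by positivity
    linarith

/-! ### The logarithm of `v` and its Taylor remainder -/

theorem exists_forall_abs_lt_ne_zero {v : ℝ → ℂ} (hv : Continuous v) {c : ℝ} (hc : 0 < c)
    (hne : ∀ t : ℝ, |t| ≤ c → v t ≠ 0) : ∃ c' > c, ∀ t : ℝ, |t| < c' → v t ≠ 0 := by
  have hopen : IsOpen {t : ℝ | v t ≠ 0} := isOpen_ne_fun hv continuous_const
  have hsub : Metric.closedBall (0 : ℝ) c ⊆ {t : ℝ | v t ≠ 0} := fun t ht =>
    hne t (by simpa using ht)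
  obtain ⟨δ, hδ, h⟩ := (isCompact_closedBall (0 : ℝ) c).exists_thickening_subset_open hopen hsub
  rw [thickening_closedBall hδ hc.le] at h
  exact ⟨δ + c, by linarith, fun t ht => h (by simpa using ht)⟩

theorem abs_le_of_mem_uIcc_zero {u t : ℝ} (h : u ∈ Set.uIcc 0 t) : |u| ≤ |t| := by
  simpa using Set.abs_sub_left_of_mem_uIcc h

theorem eventually_hasDerivAt_logBranch {v : ℝ → ℂ} (hv : ContDiff ℝ 1 v) {c : ℝ} (hc : 0 < c)
    (hne : ∀ t : ℝ, |t| ≤ c → v t ≠ 0) {t : ℝ} (ht : |t| ≤ c) :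
    ∀ᶠ u in 𝓝 t, v u ≠ 0 ∧ HasDerivAt (logBranch v) (deriv v u / v u) u := by
  obtain ⟨c', hc', h⟩ := exists_forall_abs_lt_ne_zero hv.continuous hc hne
  have : ∀ᶠ u in 𝓝 t, |u| < c' :=
    (continuous_abs.tendsto t).eventually (gt_mem_nhds (ht.trans_lt hc'))
  filter_upwards [this] with u hu
  exact ⟨h u hu, hasDerivAt_logBranch hv fun x hx => h x ((abs_le_of_mem_uIcc_zero hx).trans_lt hu)⟩

theorem contDiffAt_logBranch {v : ℝ → ℂ} {N : ℕ} (hv : ContDiff ℝ (N + 1 : ℕ) v) {c : ℝ}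
    (hc : 0 < c) (hne : ∀ t : ℝ, |t| ≤ c → v t ≠ 0) {t : ℝ} (ht : |t| ≤ c) :
    ContDiffAt ℝ (N + 1 : ℕ) (logBranch v) t := by
  have hv1 : ContDiff ℝ 1 v := hv.of_le (by exact_mod_cast Nat.le_add_left 1 N)
  obtain ⟨c', hc', h⟩ := exists_forall_abs_lt_ne_zero hv.continuous hc hne
  have hder : ∀ u ∈ Metric.ball (0 : ℝ) c', HasDerivAt (logBranch v) (deriv v u / v u) u := by
    intro u hu
    rw [mem_ball_zero_iff, Real.norm_eq_abs] at hu
    exact hasDerivAt_logBranch hv1 fun x hx => h x ((abs_le_of_mem_uIcc_zero hx).trans_lt hu)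
  have hon : ContDiffOn ℝ (N + 1 : ℕ) (logBranch v) (Metric.ball (0 : ℝ) c') := by
    push_cast
    rw [contDiffOn_succ_iff_deriv_of_isOpen Metric.isOpen_ball]
    refine ⟨fun u hu => (hder u hu).differentiableAt.differentiableWithinAt, by simp, ?_⟩
    have hd : ContDiff ℝ N (deriv v) := by
      have := hv
      push_cast at this
      exact this.deriv'
    refine ContDiffOn.congr ?_ fun u hu => (hder u hu).deriv
    have hvN : ContDiff ℝ N v := hv.of_le (by exact_mod_cast Nat.le_succ N)
    simp only [div_eq_mul_inv]
    refine hd.contDiffOn.mul (hvN.contDiffOn.inv fun u hu => ?_)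
    rw [mem_ball_zero_iff, Real.norm_eq_abs] at hu
    exact h u hu
  refine hon.contDiffAt (Metric.isOpen_ball.mem_nhds ?_)
  rw [mem_ball_zero_iff, Real.norm_eq_abs]
  exact ht.trans_lt hc'

theorem logBranch_zero (v : ℝ → ℂ) : logBranch v 0 = 0 := by simp [logBranch]

theorem deriv_logBranch_zero {v : ℝ → ℂ} (hv : ContDiff ℝ 1 v) (hv0 : v 0 = 1)
    (hv1 : deriv v 0 = 0) : deriv (logBranch v) 0 = 0 := by
  rw [(hasDerivAt_logBranch hv (t := 0) (by simp [hv0])).deriv, hv1, zero_div]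

theorem iteratedDeriv_two_logBranch_zero {v : ℝ → ℂ} (hv : ContDiff ℝ 2 v) (hv0 : v 0 = 1)
    (hv1 : deriv v 0 = 0) (hv2 : iteratedDeriv 2 v 0 = -1) {c : ℝ} (hc : 0 < c)
    (hne : ∀ t : ℝ, |t| ≤ c → v t ≠ 0) : iteratedDeriv 2 (logBranch v) 0 = -1 := by
  have hv' : ContDiff ℝ 1 v := hv.of_le (by norm_num)
  have hev : deriv (logBranch v) =ᶠ[𝓝 0] fun u => deriv v u / v u := by
    filter_upwards [eventually_hasDerivAt_logBranch hv' hc hne (t := 0) (by simpa using hc.le)]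
      with u hu using hu.2.deriv
  have hd : DifferentiableAt ℝ (deriv v) 0 := hv.differentiable_deriv_two 0
  have hd2 : deriv (deriv v) 0 = -1 := by
    rw [← hv2, iteratedDeriv_succ, iteratedDeriv_one]
  rw [iteratedDeriv_succ, iteratedDeriv_one, hev.deriv_eq,
    deriv_fun_div hd (hv'.differentiable one_ne_zero 0) (by simp [hv0]), hd2, hv0, hv1]
  simp

/-- The remainder of the Taylor expansion of `log v` at the origin, to the order `m`. -/
noncomputable def logRemainder (v : ℝ → ℂ) (m : ℕ) (τ : ℝ) : ℂ :=
  logBranch v τ - ∑ k ∈ Finset.range (m + 1),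
    iteratedDeriv k (logBranch v) 0 / (k.factorial : ℂ) * (τ : ℂ) ^ k

theorem iteratedDeriv_sum_mul_pow (b : ℕ → ℂ) (m j : ℕ) (τ : ℝ) :
    iteratedDeriv j (fun x : ℝ => ∑ k ∈ Finset.range (m + 1), b k * (x : ℂ) ^ k) τ
      = ∑ k ∈ Finset.range (m + 1), b k * ((k.descFactorial j : ℂ) * (τ : ℂ) ^ (k - j)) := by
  have hdiff : Differentiable ℂ fun x : ℂ => ∑ k ∈ Finset.range (m + 1), b k * x ^ k := by fun_prop
  rw [iteratedDeriv_comp_ofReal hdiff, iteratedDeriv_fun_sum fun k _ => by fun_prop]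
  refine Finset.sum_congr rfl fun k _ => ?_
  rw [iteratedDeriv_const_mul_field, iteratedDeriv_pow]

theorem contDiffAt_logRemainder {v : ℝ → ℂ} {m N : ℕ} {τ : ℝ}
    (h : ContDiffAt ℝ N (logBranch v) τ) : ContDiffAt ℝ N (logRemainder v m) τ := by
  refine h.sub ?_
  refine ContDiffAt.sum fun k _ => ?_
  exact contDiffAt_const.mul (Complex.ofRealCLM.contDiff.contDiffAt.pow k)

theorem iteratedDeriv_logRemainder {v : ℝ → ℂ} {m j : ℕ} {τ : ℝ}
    (h : ContDiffAt ℝ j (logBranch v) τ) :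
    iteratedDeriv j (logRemainder v m) τ = iteratedDeriv j (logBranch v) τ
      - ∑ k ∈ Finset.range (m + 1), iteratedDeriv k (logBranch v) 0 / (k.factorial : ℂ)
        * ((k.descFactorial j : ℂ) * (τ : ℂ) ^ (k - j)) := by
  rw [← iteratedDeriv_sum_mul_pow]
  refine iteratedDeriv_fun_sub h (ContDiffAt.sum fun k _ => ?_)
  exact contDiffAt_const.mul (Complex.ofRealCLM.contDiff.contDiffAt.pow k)

theorem iteratedDeriv_logRemainder_zero {v : ℝ → ℂ} {m j : ℕ} (hj : j ≤ m)
    (h : ContDiffAt ℝ j (logBranch v) 0) : iteratedDeriv j (logRemainder v m) 0 = 0 := by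
  rw [iteratedDeriv_logRemainder h, Finset.sum_eq_single j]
  · rw [Nat.descFactorial_self, Nat.sub_self, pow_zero, mul_one,
      div_mul_cancel₀ _ (by exact_mod_cast j.factorial_ne_zero), sub_self]
  · intro k _ hkj
    rcases Nat.lt_or_gt_of_ne hkj with h1 | h1
    · rw [Nat.descFactorial_of_lt h1]; simp
    · rw [Complex.ofReal_zero, zero_pow (by omega)]; simp
  · intro h1
    exact absurd (Finset.mem_range.2 (Nat.lt_succ_of_le hj)) h1

theorem iteratedDeriv_logRemainder_top {v : ℝ → ℂ} {m : ℕ} {τ : ℝ}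
    (h : ContDiffAt ℝ m (logBranch v) τ) : iteratedDeriv m (logRemainder v m) τ
      = iteratedDeriv m (logBranch v) τ - iteratedDeriv m (logBranch v) 0 := by
  rw [iteratedDeriv_logRemainder h, Finset.sum_range_succ, Finset.sum_eq_zero, zero_add]
  · rw [Nat.descFactorial_self, Nat.sub_self, pow_zero, mul_one,
      div_mul_cancel₀ _ (by exact_mod_cast m.factorial_ne_zero)]
  · intro k hk
    rw [Nat.descFactorial_of_lt (Finset.mem_range.1 hk)]; simp

theorem logBranch_div_sq {v : ℝ → ℂ} (n : ℕ) (h1 : deriv (logBranch v) 0 = 0)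
    (h2 : iteratedDeriv 2 (logBranch v) 0 = -1) {z : ℝ} (hz : z ≠ 0) (t : ℝ) :
    logBranch v (t * z) / (z : ℂ) ^ 2 = -(t : ℂ) ^ 2 / 2
      + ∑ j : Fin n, logTerm (cumulant v) z t j + logRemainder v (n + 2) (z * t) / (z : ℂ) ^ 2 := by
  have hz' : (z : ℂ) ≠ 0 := by exact_mod_cast hz
  have hsum : ∑ j : Fin n, logTerm (cumulant v) z t j
      = (∑ k ∈ Finset.range n, iteratedDeriv (k + 3) (logBranch v) 0 / ((k + 3).factorial : ℂ)
          * ((z * t : ℝ) : ℂ) ^ (k + 3)) / (z : ℂ) ^ 2 := by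
    rw [Fin.sum_univ_eq_sum_range (logTerm (cumulant v) z t), Finset.sum_div]
    refine Finset.sum_congr rfl fun k _ => ?_
    rw [logTerm, cumulant, mul_pow, Complex.ofReal_mul, mul_pow]
    have hI : Complex.I ^ (k + 3) ≠ 0 := pow_ne_zero _ Complex.I_ne_zero
    have hf : ((k + 3).factorial : ℂ) ≠ 0 := by exact_mod_cast (k + 3).factorial_ne_zero
    field_simp
    ring
  rw [hsum, logRemainder, Finset.sum_range_succ', Finset.sum_range_succ', Finset.sum_range_succ']
  simp only [zero_add, iteratedDeriv_zero, logBranch_zero, iteratedDeriv_one, h1, Nat.reduceAdd, h2,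
    zero_div, zero_mul, add_zero, Nat.factorial_two, mul_comm z t, add_assoc]
  push_cast
  field_simp
  ring

/-- Differentiate `v · (log v)' = v'` by the Leibniz rule: apart from `v⁽ᵐ⁾`, the derivative
`(log v)⁽ᵐ⁾` only involves functions which are differentiable at `0`. -/
theorem exists_iteratedDeriv_logBranch_eq {v : ℝ → ℂ} {m : ℕ} (hm : 1 ≤ m)
    (hv : ContDiff ℝ m v) {c : ℝ} (hc : 0 < c) (hne : ∀ t : ℝ, |t| ≤ c → v t ≠ 0) :
    ∃ h : ℝ → ℂ, DifferentiableAt ℝ h 0 ∧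
      ∀ᶠ τ in 𝓝 0, iteratedDeriv m (logBranch v) τ = (iteratedDeriv m v τ - h τ) / v τ := by
  obtain ⟨N, rfl⟩ : ∃ N, m = N + 1 := ⟨m - 1, by omega⟩
  have hv1 : ContDiff ℝ 1 v := hv.of_le (by exact_mod_cast hm)
  have hL : ContDiffAt ℝ (N + 1 : ℕ) (logBranch v) 0 :=
    contDiffAt_logBranch hv hc hne (by simpa using hc.le)
  refine ⟨fun τ => ∑ i ∈ Finset.range N, (N.choose (i + 1) : ℂ) * iteratedDeriv (i + 1) v τ
    * iteratedDeriv (N - (i + 1) + 1) (logBranch v) τ, ?_, ?_⟩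
  · refine DifferentiableAt.fun_sum fun i hi => ?_
    have hi' := Finset.mem_range.1 hi
    have d1 : DifferentiableAt ℝ (iteratedDeriv (i + 1) v) 0 :=
      (contDiffAt_iteratedDeriv (k := 1) _ hv.contDiffAt (by omega)).differentiableAt (by simp)
    have d2 : DifferentiableAt ℝ (iteratedDeriv (N - (i + 1) + 1) (logBranch v)) 0 :=
      (contDiffAt_iteratedDeriv (k := 1) _ hL (by omega)).differentiableAt (by simp)
    exact ((differentiableAt_const _).mul d1).mul d2
  · have hev := eventually_hasDerivAt_logBranch hv1 hc hne (t := 0) (by simpa using hc.le)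
    filter_upwards [hev.eventually_nhds, hL.eventually (by simp)] with τ h1 h2
    have hvτ : v τ ≠ 0 := h1.self_of_nhds.1
    have heq : (v * deriv (logBranch v)) =ᶠ[𝓝 τ] deriv v := by
      filter_upwards [h1] with u hu
      rw [Pi.mul_apply, hu.2.deriv, mul_div_cancel₀ _ hu.1]
    have hL' : ContDiffAt ℝ N (deriv (logBranch v)) τ :=
      iteratedDeriv_one (f := logBranch v) ▸ contDiffAt_iteratedDeriv 1 h2 le_rfl
    have hvN : ContDiffAt ℝ N v τ := (hv.of_le (by exact_mod_cast Nat.le_succ N)).contDiffAt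
    have hmul := iteratedDeriv_mul hvN hL'
    rw [heq.iteratedDeriv_eq, ← iteratedDeriv_succ', Finset.sum_range_succ'] at hmul
    simp only [← iteratedDeriv_succ', Nat.choose_zero_right, Nat.cast_one, one_mul,
      iteratedDeriv_zero, Nat.sub_zero] at hmul
    rw [eq_div_iff hvτ, hmul]
    ring

theorem isLittleO_abs_rpow {α : ℝ} (hα : 0 ≤ α) (hα1 : α < 1) :
    (fun τ : ℝ => τ) =o[𝓝 0] fun τ : ℝ => |τ| ^ α := by
  have h1 : Tendsto (fun τ : ℝ => |τ| ^ (1 - α)) (𝓝 0) (𝓝 0) := by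
    have : ContinuousAt (fun τ : ℝ => |τ| ^ (1 - α)) 0 :=
      continuous_abs.continuousAt.rpow_const (Or.inr (by linarith))
    simpa [ContinuousAt, Real.zero_rpow (show 1 - α ≠ 0 by linarith)] using this
  have h2 : (fun τ : ℝ => |τ| ^ (1 - α)) =o[𝓝 0] fun _ : ℝ => (1 : ℝ) :=
    (isLittleO_one_iff ℝ).2 h1
  have h3 := h2.mul_isBigO (isBigO_refl (fun τ : ℝ => |τ| ^ α) (𝓝 0))
  refine IsLittleO.of_norm_left ((h3.congr_right fun τ => one_mul _).congr_left fun τ => ?_)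
  rw [Real.norm_eq_abs, ← Real.rpow_add_of_nonneg (abs_nonneg _) (by linarith) hα,
    sub_add_cancel, Real.rpow_one]

theorem isLittleO_iteratedDeriv_logBranch_sub {v : ℝ → ℂ} {m : ℕ} (hm : 1 ≤ m)
    (hv : ContDiff ℝ m v) {c : ℝ} (hc : 0 < c) (hne : ∀ t : ℝ, |t| ≤ c → v t ≠ 0) {α : ℝ}
    (hα : 0 ≤ α) (hα1 : α < 1)
    (ho : (fun τ => iteratedDeriv m v τ - iteratedDeriv m v 0) =o[𝓝 0] fun τ : ℝ => |τ| ^ α) :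
    (fun τ => iteratedDeriv m (logBranch v) τ - iteratedDeriv m (logBranch v) 0)
      =o[𝓝 0] fun τ : ℝ => |τ| ^ α := by
  obtain ⟨h, hd, heq⟩ := exists_iteratedDeriv_logBranch_eq hm hv hc hne
  have hv1 : ContDiff ℝ 1 v := hv.of_le (by exact_mod_cast hm)
  have hv0 : v 0 ≠ 0 := hne 0 (by simpa using hc.le)
  have hdv : DifferentiableAt ℝ v 0 := hv1.differentiable one_ne_zero 0
  have hg : DifferentiableAt ℝ (fun τ => (iteratedDeriv m v 0 - h τ) * (v τ)⁻¹) 0 :=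
    ((differentiableAt_const _).sub hd).mul (hdv.inv hv0)
  have hg' := hg.isBigO_sub
  simp only [sub_zero] at hg'
  have h1 := hg'.trans_isLittleO (isLittleO_abs_rpow hα hα1)
  have hb : (fun τ => (v τ)⁻¹) =O[𝓝 0] fun _ : ℝ => (1 : ℝ) :=
    (hdv.inv hv0).continuousAt.isBigO_one ℝ
  have h2 := ho.mul_isBigO hb
  simp only [mul_one] at h2
  refine (h2.add h1).congr' ?_ EventuallyEq.rfl
  filter_upwards [heq] with τ hτ
  rw [hτ, heq.self_of_nhds]
  ring

theorem isBigO_iteratedDeriv_logBranch_sub {v : ℝ → ℂ} {m : ℕ}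
    (hv : ContDiff ℝ (m + 1 : ℕ) v) {c : ℝ} (hc : 0 < c) (hne : ∀ t : ℝ, |t| ≤ c → v t ≠ 0) :
    (fun τ => iteratedDeriv m (logBranch v) τ - iteratedDeriv m (logBranch v) 0)
      =O[𝓝 0] fun τ : ℝ => |τ| := by
  have hL : ContDiffAt ℝ (m + 1 : ℕ) (logBranch v) 0 :=
    contDiffAt_logBranch hv hc hne (by simpa using hc.le)
  have hd : DifferentiableAt ℝ (iteratedDeriv m (logBranch v)) 0 :=
    (contDiffAt_iteratedDeriv (k := 1) m hL (by omega)).differentiableAt (by simp)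
  simpa using hd.isBigO_sub.norm_right

/-! ### The estimate away from the origin -/

theorem norm_cexp_neg_sq_div_two_le {t M : ℝ} (hM : M = |t| + |t|⁻¹) (ht : t ≠ 0) {ζ : ℂ}
    (hζ : ‖ζ - t‖ = M⁻¹) :
    ‖ζ‖ ≤ 2 * |t| ∧ ‖Complex.exp (-ζ ^ 2 / 2)‖ ≤ Real.exp 2 * Real.exp (-t ^ 2 / 2) := by
  have ht' : 0 < |t| := abs_pos.2 ht
  have hMpos : 0 < M := by rw [hM]; positivity
  have hr1 : M⁻¹ ≤ |t| := by
    rw [inv_le_comm₀ hMpos ht', hM]; linarith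
  have hr2 : |t| * M⁻¹ ≤ 1 := by
    rw [← div_eq_mul_inv, div_le_one hMpos, hM]
    have : 0 < |t|⁻¹ := by positivity
    linarith
  have hr0 : 0 < M⁻¹ := inv_pos.2 hMpos
  obtain ⟨w, rfl⟩ : ∃ w, ζ = t + w := ⟨ζ - t, by ring⟩
  rw [add_sub_cancel_left] at hζ
  constructor
  · refine (norm_add_le _ _).trans ?_
    rw [Complex.norm_real, Real.norm_eq_abs, hζ]
    linarith
  · rw [Complex.norm_exp, ← Real.exp_add]
    refine Real.exp_le_exp.2 ?_
    have e : -((t : ℂ) + w) ^ 2 / 2 = ((-t ^ 2 / 2 : ℝ) : ℂ) + (-(t * w) - w ^ 2 / 2) := by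
      push_cast; ring
    rw [e, Complex.add_re, Complex.ofReal_re]
    have h1 : (-(t * w) - w ^ 2 / 2 : ℂ).re ≤ |t| * M⁻¹ + M⁻¹ ^ 2 / 2 := by
      refine (Complex.re_le_norm _).trans ((norm_sub_le _ _).trans ?_)
      rw [norm_neg, norm_mul, norm_div, norm_pow, hζ, Complex.norm_real, Real.norm_eq_abs]
      simp
    have h2 : M⁻¹ ^ 2 ≤ 1 := by nlinarith
    linarith

theorem iteratedDeriv_comp_mul_left_div (R : ℝ → ℂ) (z : ℝ) (j : ℕ) (t : ℝ) :
    iteratedDeriv j (fun x => R (z * x) / (z : ℂ) ^ 2) t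
      = z ^ j • iteratedDeriv j R (z * t) / (z : ℂ) ^ 2 := by
  rw [iteratedDeriv_div_const, iteratedDeriv_comp_mul_left]

/-- The bounds for `t ≠ 0` are expressed through `M = |t| + |t|⁻¹`, of which `M⁻¹` is the radius
used in Cauchy's estimate: it is at most `|t|`, so that `|ζ|` remains comparable with `|t|`, and
`|t| M⁻¹ ≤ 1`, so that `|e^{-ζ²/2}|` remains comparable with `e^{-t²/2}`. -/
theorem exists_norm_iteratedDeriv_le_of_ne_zero (γ : ℕ → ℂ) (R : ℝ → ℂ) (n : ℕ) {σ c K₀ : ℝ}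
    (hσ3 : 3 ≤ σ) (hσm : (n : ℝ) + 2 ≤ σ) (hσ : σ ≤ n + 3) (hc : 0 < c) (hK₀ : 0 ≤ K₀)
    (hR : ∀ τ, |τ| ≤ c → ContDiffAt ℝ (n + 2 : ℕ) R τ)
    (hR0 : ∀ j < n + 2, iteratedDeriv j R 0 = 0) :
    ∃ C : ℝ, 0 ≤ C ∧ ∀ z : ℝ, 0 < |z| → |z| ≤ 1 → ∀ K δ : ℝ, 0 ≤ K → K ≤ K₀ → δ ≤ c →
      (∀ τ, |τ| ≤ δ → ‖iteratedDeriv (n + 2) R τ‖ ≤ K * |τ| ^ (σ - (n + 2))) →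
      ∀ t : ℝ, t ≠ 0 → |z * t| ≤ δ → |t ^ 3 * z| ≤ c ^ 3 → ∀ p ≤ n + 2,
        ‖iteratedDeriv p (fun x : ℝ => Complex.exp (-(x : ℂ) ^ 2 / 2
            + ∑ j : Fin n, logTerm γ z x j + R (z * x) / (z : ℂ) ^ 2)
          - Complex.exp (-(x : ℂ) ^ 2 / 2) * ∑ q ∈ exponentBox n with weight q ≤ n,
              expTerm (logTerm γ z x) q) t‖
        ≤ C * (K + |z| ^ (n + 3 - σ)) * |z| ^ (σ - 2) * (|t| ^ σ + |t| ^ (3 * n + σ))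
          * (|t| + |t|⁻¹) ^ p * Real.exp (-t ^ 2 / 2) := by
  set B : ℝ := 1 + 2 * c + 8 * c ^ 3 with hB
  have hc3 : 0 < c ^ 3 := by positivity
  have hB1 : 1 ≤ B := by rw [hB]; linarith
  obtain ⟨C₁, hC₁, hE⟩ := exists_norm_exp_sub_sum_expTerm_le γ n hB1
  obtain ⟨C₂, hC₂, hX⟩ := exists_norm_iteratedDeriv_exp_sub_one_le (n + 2)
    (K₀ * (c ^ 3 * c ^ (σ - 3)))
  set F : ℝ := ((n + 2).factorial : ℝ) with hF
  have hF0 : 0 ≤ F := by positivity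
  refine ⟨2 ^ (n + 2) * (F * Real.exp 2 * C₁) * C₂
    + F * (Real.exp 2 * C₁ * (2 ^ (3 * n + 3) * 2)), by positivity, ?_⟩
  intro z hz hz1 K δ hK hKK₀ hδ hRK t ht htδ htz p hp
  have hz0 : z ≠ 0 := abs_pos.1 hz
  set x := |t| with hx
  set y := |z| with hy
  have hx0 : 0 < x := abs_pos.2 ht
  have hxy : x * y ≤ c := by
    have := htδ.trans hδ
    rwa [abs_mul, mul_comm] at this
  have hxy3 : x ^ 3 * y ≤ c ^ 3 := by rwa [abs_mul, abs_pow] at htz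
  set M := x + x⁻¹ with hM
  have hMpos : 0 < M := by positivity
  set G := Real.exp (-t ^ 2 / 2) with hG
  have hG0 : 0 < G := Real.exp_pos _
  set W := K + y ^ (n + 3 - σ) with hW
  have hyp : 0 ≤ y ^ ((n : ℝ) + 3 - σ) := by positivity
  set X := x ^ σ + x ^ (3 * n + σ) with hXdef
  have hX0 : 0 ≤ X := by positivity
  set Y := y ^ (σ - 2) with hY
  have hY0 : 0 ≤ Y := by positivity
  -- the two entire factors
  let A : ℂ → ℂ := fun ζ => Complex.exp (-ζ ^ 2 / 2) * Complex.exp (∑ j : Fin n, logTerm γ z ζ j)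
  let H : ℂ → ℂ := fun ζ => Complex.exp (-ζ ^ 2 / 2) * (Complex.exp (∑ j : Fin n, logTerm γ z ζ j)
    - ∑ q ∈ exponentBox n with weight q ≤ n, expTerm (logTerm γ z ζ) q)
  let Rz : ℝ → ℂ := fun u => R (z * u) / (z : ℂ) ^ 2
  have hlogd : ∀ j : ℕ, Differentiable ℂ fun ζ => logTerm γ z ζ j := fun j => by
    unfold logTerm; fun_prop
  have htermd : ∀ q : Fin n → ℕ, Differentiable ℂ fun ζ => expTerm (logTerm γ z ζ) q := fun q => by
    unfold expTerm; fun_prop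
  have hAd : Differentiable ℂ A := by fun_prop
  have hHd : Differentiable ℂ H := by fun_prop
  have hsphere : ∀ ζ : ℂ, ‖ζ - t‖ = M⁻¹ → ‖ζ‖ ≤ 2 * x ∧ ‖ζ‖ * |z| ≤ B ∧ ‖ζ‖ ^ 3 * |z| ≤ B := by
    intro ζ hζ
    have h1 := (norm_cexp_neg_sq_div_two_le hM ht hζ).1
    refine ⟨h1, ?_, ?_⟩
    · calc ‖ζ‖ * y ≤ 2 * x * y := by gcongr
        _ ≤ B := by rw [hB]; linarith
    · calc ‖ζ‖ ^ 3 * y ≤ (2 * x) ^ 3 * y := by gcongr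
        _ = 8 * (x ^ 3 * y) := by ring
        _ ≤ B := by rw [hB]; linarith
  have hAb : ∀ j ≤ n + 2, ‖iteratedDeriv j (fun u : ℝ => A u) t‖
      ≤ F * (Real.exp 2 * G * C₁) * M ^ j := by
    intro j hj
    refine (norm_iteratedDeriv_comp_ofReal_le hAd hMpos (B := Real.exp 2 * G * C₁)
      (fun ζ hζ => ?_) j).trans ?_
    · obtain ⟨-, h2, h3⟩ := hsphere ζ hζ
      rw [norm_mul]
      exact mul_le_mul (norm_cexp_neg_sq_div_two_le hM ht hζ).2 (hE ζ z hz1 h2 h3).1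
        (norm_nonneg _) (by positivity)
    · have : (j.factorial : ℝ) ≤ F := by rw [hF]; exact_mod_cast Nat.factorial_le hj
      gcongr
  have hpow : x ^ (n + 3) + x ^ (3 * (n + 1)) ≤ 2 * X := by
    have e1 : x ^ (n + 3) = x ^ ((n : ℝ) + 3) := by
      rw [← Real.rpow_natCast]; push_cast; rfl
    have e2 : x ^ (3 * (n + 1)) = x ^ (3 * (n : ℝ) + 3) := by
      rw [← Real.rpow_natCast]; push_cast; ring_nf
    have hn : (0 : ℝ) ≤ n := Nat.cast_nonneg n
    have p1 : 0 ≤ x ^ σ := by positivity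
    have p2 : 0 ≤ x ^ (3 * n + σ) := by positivity
    rw [e1, e2]
    rcases le_total x 1 with h | h
    · have h1 := Real.rpow_le_rpow_of_exponent_ge hx0 h hσ
      have h2 := Real.rpow_le_rpow_of_exponent_ge hx0 h (show σ ≤ 3 * (n : ℝ) + 3 by linarith)
      linarith
    · have h1 := Real.rpow_le_rpow_of_exponent_le h
        (show (n : ℝ) + 3 ≤ 3 * n + σ by linarith)
      have h2 := Real.rpow_le_rpow_of_exponent_le h
        (show 3 * (n : ℝ) + 3 ≤ 3 * n + σ by linarith)
      linarith
  have hyn : y ^ (n + 1) = y ^ ((n : ℝ) + 3 - σ) * Y := by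
    rw [hY, ← Real.rpow_add hz, ← Real.rpow_natCast]
    congr 1; push_cast; ring
  have hHb : ‖iteratedDeriv p (fun u : ℝ => H u) t‖
      ≤ F * (Real.exp 2 * C₁ * (2 ^ (3 * n + 3) * 2)) * y ^ ((n : ℝ) + 3 - σ) * Y * X * M ^ p
        * G := by
    refine (norm_iteratedDeriv_comp_ofReal_le hHd hMpos
      (B := Real.exp 2 * G * (C₁ * (y ^ (n + 1) * (2 ^ (3 * n + 3) * (2 * X)))))
      (fun ζ hζ => ?_) p).trans ?_
    · obtain ⟨h1, h2, h3⟩ := hsphere ζ hζ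
      rw [norm_mul]
      refine mul_le_mul (norm_cexp_neg_sq_div_two_le hM ht hζ).2
        ((hE ζ z hz1 h2 h3).2.trans ?_) (norm_nonneg _) (by positivity)
      have h4 : ‖ζ‖ ^ (n + 3) + ‖ζ‖ ^ (3 * (n + 1))
          ≤ 2 ^ (3 * n + 3) * (x ^ (n + 3) + x ^ (3 * (n + 1))) := by
        calc _ ≤ (2 * x) ^ (n + 3) + (2 * x) ^ (3 * (n + 1)) := by gcongr
          _ = 2 ^ (n + 3) * x ^ (n + 3) + 2 ^ (3 * n + 3) * x ^ (3 * (n + 1)) := by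
            rw [mul_pow, mul_pow]; ring
          _ ≤ 2 ^ (3 * n + 3) * x ^ (n + 3) + 2 ^ (3 * n + 3) * x ^ (3 * (n + 1)) := by
            gcongr
            · norm_num
            · omega
          _ = _ := by ring
      gcongr
      exact h4.trans (by gcongr)
    · have : (p.factorial : ℝ) ≤ F := by rw [hF]; exact_mod_cast Nat.factorial_le hp
      calc _ ≤ F * (Real.exp 2 * G * (C₁ * (y ^ (n + 1) * (2 ^ (3 * n + 3) * (2 * X)))))
            * M ^ p := by gcongr
        _ = _ := by rw [hyn]; ring
  -- the remainder of the logarithm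
  set ω := K * Y * x ^ σ with hω
  have hω0 : 0 ≤ ω := by positivity
  have hωle : ω ≤ K₀ * (c ^ 3 * c ^ (σ - 3)) := by
    have e : Y * x ^ σ = (x ^ 3 * y) * (x * y) ^ (σ - 3) := by
      rw [hY, Real.mul_rpow hx0.le hz.le]
      have e1 : x ^ σ = x ^ 3 * x ^ (σ - 3) := by
        rw [← Real.rpow_natCast, ← Real.rpow_add hx0]; congr 1; push_cast; ring
      have e2 : y ^ (σ - 2) = y * y ^ (σ - 3) := by
        rw [← Real.rpow_one_add' hz.le (by linarith)]; congr 1; ring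
      rw [e1, e2]; ring
    rw [hω, mul_assoc, e]
    have : (x * y) ^ (σ - 3) ≤ c ^ (σ - 3) :=
      Real.rpow_le_rpow (by positivity) hxy (by linarith)
    gcongr
  have hRzb : ∀ j ≤ n + 2, ‖iteratedDeriv j Rz t‖ ≤ ω * M ^ j := by
    intro j hj
    rw [iteratedDeriv_comp_mul_left_div, norm_div, norm_smul, norm_pow, norm_pow,
      Complex.norm_real, Real.norm_eq_abs]
    have h1 := norm_iteratedDeriv_le_of_norm_iteratedDeriv_le (α := σ - (n + 2)) (by linarith) hK
      (fun τ hτ => hR τ (hτ.trans hδ)) hR0 hRK (n + 2 - j) j (by omega) (z * t) htδ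
    have e1 : σ - ((n : ℝ) + 2) + ((n + 2 - j : ℕ) : ℝ) = σ - j := by
      rw [Nat.cast_sub hj]; push_cast; ring
    rw [e1, abs_mul, Real.mul_rpow hz.le hx0.le] at h1
    have e2 : y ^ j * (K * (y ^ (σ - j) * x ^ (σ - j))) / y ^ 2 = ω * x⁻¹ ^ j := by
      rw [Real.rpow_sub hz, Real.rpow_sub hx0, hω, hY, Real.rpow_sub hz, Real.rpow_natCast,
        Real.rpow_natCast, Real.rpow_two, inv_pow]
      have := hz.ne'
      have := hx0.ne'
      field_simp
    calc _ ≤ y ^ j * (K * (y ^ (σ - j) * x ^ (σ - j))) / y ^ 2 := by gcongr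
      _ = ω * x⁻¹ ^ j := e2
      _ ≤ ω * M ^ j := by
        have : x⁻¹ ≤ M := by rw [hM]; linarith
        gcongr
  have hzt : |z * t| ≤ c := htδ.trans hδ
  have hRzc : ContDiffAt ℝ (n + 2 : ℕ) Rz t :=
    ((hR (z * t) hzt).comp t (contDiff_const.mul contDiff_id).contDiffAt).div_const _
  have hexpR : ContDiffAt ℝ (n + 2 : ℕ) (fun u => Complex.exp (Rz u) - 1) t :=
    hRzc.cexp.sub contDiffAt_const
  have hAc : ∀ {Φ : ℂ → ℂ}, Differentiable ℂ Φ → ContDiffAt ℝ (n + 2 : ℕ) (fun u : ℝ => Φ u) t :=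
    fun hΦ => ((hΦ.contDiff.restrict_scalars ℝ).comp Complex.ofRealCLM.contDiff).contDiffAt
  have hp' : ((p : ℕ) : WithTop ℕ∞) ≤ ((n + 2 : ℕ) : WithTop ℕ∞) := by exact_mod_cast hp
  have hdecomp : (fun u : ℝ => Complex.exp (-(u : ℂ) ^ 2 / 2
            + ∑ j : Fin n, logTerm γ z u j + R (z * u) / (z : ℂ) ^ 2)
          - Complex.exp (-(u : ℂ) ^ 2 / 2) * ∑ q ∈ exponentBox n with weight q ≤ n,
              expTerm (logTerm γ z u) q)
      = fun u : ℝ => A u * (Complex.exp (Rz u) - 1) + H u := by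
    funext u
    simp only [A, H, Rz, Complex.exp_add]
    ring
  have hprod : ‖iteratedDeriv p (fun u : ℝ => A u * (Complex.exp (Rz u) - 1)) t‖
      ≤ 2 ^ p * (F * (Real.exp 2 * G * C₁) * (C₂ * ω)) * M ^ p :=
    norm_iteratedDeriv_mul_le ((hAc hAd).of_le hp') (hexpR.of_le hp')
      (fun j hj => hAb j (hj.trans hp))
      (fun j hj => hX Rz t M ω hRzc hMpos.le hωle hRzb j (hj.trans hp))
  rw [hdecomp, iteratedDeriv_fun_add (((hAc hAd).mul hexpR).of_le hp') ((hAc hHd).of_le hp')]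
  refine (norm_add_le _ _).trans ((add_le_add hprod hHb).trans ?_)
  have hxX : x ^ σ ≤ X := by
    have : 0 ≤ x ^ (3 * n + σ) := by positivity
    rw [hXdef]; linarith
  have h2p : (2 : ℝ) ^ p ≤ 2 ^ (n + 2) := pow_le_pow_right₀ (by norm_num) hp
  have t1 : 2 ^ p * (F * (Real.exp 2 * G * C₁) * (C₂ * ω)) * M ^ p
      ≤ 2 ^ (n + 2) * (F * Real.exp 2 * C₁) * C₂ * (W * Y * X * M ^ p * G) := by
    have hKW : K ≤ W := by rw [hW]; linarith
    have hωW : ω ≤ W * Y * X := by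
      rw [hω]; gcongr
    calc _ ≤ 2 ^ (n + 2) * (F * (Real.exp 2 * G * C₁) * (C₂ * (W * Y * X))) * M ^ p := by gcongr
      _ = _ := by ring
  have t2 : F * (Real.exp 2 * C₁ * (2 ^ (3 * n + 3) * 2)) * y ^ ((n : ℝ) + 3 - σ) * Y * X * M ^ p
      * G ≤ F * (Real.exp 2 * C₁ * (2 ^ (3 * n + 3) * 2)) * (W * Y * X * M ^ p * G) := by
    have hyW : y ^ ((n : ℝ) + 3 - σ) ≤ W := by rw [hW]; linarith
    calc _ ≤ F * (Real.exp 2 * C₁ * (2 ^ (3 * n + 3) * 2)) * W * Y * X * M ^ p * G := by gcongr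
      _ = _ := by ring
  calc _ ≤ _ := add_le_add t1 t2
    _ = _ := by ring

theorem rpow_add_rpow_mul_pow_le {n p : ℕ} {σ x : ℝ} (hx : 0 < x) :
    (x ^ σ + x ^ (3 * n + σ)) * (x + x⁻¹) ^ p
      ≤ 2 ^ (p + 1) * (x ^ expLow σ p + x ^ expHigh (n + 2) σ p) := by
  have hlow : 0 ≤ x ^ expLow σ p := by positivity
  have hhigh : 0 ≤ x ^ expHigh (n + 2) σ p := by positivity
  have hn : (0 : ℝ) ≤ 3 * n := by positivity
  have e1 : 3 * (n : ℝ) + σ + p ≤ expHigh (n + 2) σ p := by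
    rw [expHigh]; push_cast
    have := le_max_left (σ + (p : ℝ)) ((σ - 1) * p)
    linarith
  rcases le_total x 1 with h | h
  · have h1 : x ^ (3 * n + σ) ≤ x ^ σ := Real.rpow_le_rpow_of_exponent_ge hx h (by linarith)
    have h2 : x + x⁻¹ ≤ 2 * x⁻¹ := by
      have := (one_le_inv₀ hx).2 h
      linarith
    calc _ ≤ (x ^ σ + x ^ σ) * (2 * x⁻¹) ^ p := by gcongr
      _ = 2 ^ (p + 1) * x ^ expLow σ p := by
        rw [expLow, Real.rpow_sub hx, Real.rpow_natCast, mul_pow, inv_pow]; ring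
      _ ≤ _ := by gcongr; linarith
  · have h1 : x ^ σ ≤ x ^ (3 * n + σ) := Real.rpow_le_rpow_of_exponent_le h (by linarith)
    have h2 : x + x⁻¹ ≤ 2 * x := by
      have := inv_le_one_of_one_le₀ h
      linarith
    calc _ ≤ (x ^ (3 * n + σ) + x ^ (3 * n + σ)) * (2 * x) ^ p := by gcongr
      _ = 2 ^ (p + 1) * x ^ (3 * n + σ + p) := by
        rw [Real.rpow_add hx _ (p : ℝ), Real.rpow_natCast, mul_pow]; ring
      _ ≤ 2 ^ (p + 1) * x ^ expHigh (n + 2) σ p := by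
        gcongr
      _ ≤ _ := by gcongr; linarith

/-! ### The estimate at all points, and the choice of the constants -/

/-- The value at `t = 0` is obtained from `t ≠ 0` by continuity: all exponents of `|t|` involved
are non-negative. -/
theorem exists_norm_iteratedDeriv_powerFun_sub_le {v : ℝ → ℂ} {n : ℕ} {σ c K₀ : ℝ}
    (hσ3 : 3 ≤ σ) (hσm : (n : ℝ) + 2 ≤ σ) (hσ : σ ≤ n + 3) (hc : 0 < c) (hK₀ : 0 ≤ K₀)
    (hv : ContDiff ℝ (n + 2 : ℕ) v) (hv0 : v 0 = 1) (hv1 : deriv v 0 = 0)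
    (hv2 : iteratedDeriv 2 v 0 = -1) (hne : ∀ t : ℝ, |t| ≤ c → v t ≠ 0) :
    ∃ C : ℝ, 0 ≤ C ∧ ∀ z : ℝ, 0 < |z| → |z| ≤ 1 → ∀ K δ : ℝ, 0 ≤ K → K ≤ K₀ → 0 < δ → δ ≤ c →
      (∀ τ, |τ| ≤ δ → ‖iteratedDeriv (n + 2) (logBranch v) τ
        - iteratedDeriv (n + 2) (logBranch v) 0‖ ≤ K * |τ| ^ (σ - (n + 2))) →
      ∀ t : ℝ, |z * t| ≤ δ → |t ^ 3 * z| ≤ c ^ 3 → ∀ p ≤ n + 2,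
        ‖iteratedDeriv p (powerFun v z) t - iteratedDeriv p (edgeworthApprox v (n + 2) z) t‖
          ≤ (|t| ^ expLow σ p + |t| ^ expHigh (n + 2) σ p) * Real.exp (-t ^ 2 / 2)
            * |z| ^ (σ - 2) * (C * (K + |z| ^ (n + 3 - σ))) := by
  have hvone : ContDiff ℝ 1 v := hv.of_le (by exact_mod_cast (show 1 ≤ n + 2 by omega))
  have hvtwo : ContDiff ℝ 2 v := hv.of_le (by exact_mod_cast (show 2 ≤ n + 2 by omega))
  have hLc : ∀ τ, |τ| ≤ c → ContDiffAt ℝ (n + 2 : ℕ) (logBranch v) τ := fun τ hτ =>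
    contDiffAt_logBranch (N := n + 1) hv hc hne hτ
  have hL0 : ContDiffAt ℝ (n + 2 : ℕ) (logBranch v) 0 := hLc 0 (by simpa using hc.le)
  have hL1 := deriv_logBranch_zero hvone hv0 hv1
  have hL2 := iteratedDeriv_two_logBranch_zero hvtwo hv0 hv1 hv2 hc hne
  obtain ⟨C, hC, hmain⟩ := exists_norm_iteratedDeriv_le_of_ne_zero (cumulant v)
    (logRemainder v (n + 2)) n hσ3 hσm hσ hc hK₀ (fun τ hτ => contDiffAt_logRemainder (hLc τ hτ))
    (fun j hj => iteratedDeriv_logRemainder_zero hj.le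
      (hL0.of_le (by exact_mod_cast hj.le)))
  refine ⟨C * 2 ^ (n + 3), by positivity, ?_⟩
  intro z hz hz1 K δ hK hKK₀ hδ0 hδ hRK
  have hz0 : z ≠ 0 := abs_pos.1 hz
  have hpow : powerFun v z = fun x : ℝ => Complex.exp (-(x : ℂ) ^ 2 / 2
      + ∑ j : Fin n, logTerm (cumulant v) z x j
      + logRemainder v (n + 2) (z * x) / (z : ℂ) ^ 2) := by
    funext x
    rw [powerFun, logBranch_div_sq n hL1 hL2 hz0]
  have happ : edgeworthApprox v (n + 2) z = fun x : ℝ => Complex.exp (-(x : ℂ) ^ 2 / 2)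
      * ∑ q ∈ exponentBox n with weight q ≤ n, expTerm (logTerm (cumulant v) z x) q := by
    funext x
    rw [edgeworthApprox, Nat.add_sub_cancel, one_add_sum_edgeworthPoly]
  have hpc : ∀ t, |z * t| ≤ c → ContDiffAt ℝ (n + 2 : ℕ) (powerFun v z) t := by
    intro t ht
    have h1 : ContDiffAt ℝ (n + 2 : ℕ) (fun x : ℝ => logBranch v (x * z)) t :=
      (hLc (t * z) (by rwa [mul_comm])).comp t (contDiff_id.mul contDiff_const).contDiffAt
    exact (h1.div_const _).cexp
  have hac : ∀ t, ContDiffAt ℝ (n + 2 : ℕ) (edgeworthApprox v (n + 2) z) t := by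
    intro t
    rw [happ]
    have hd : Differentiable ℂ fun x : ℂ => Complex.exp (-x ^ 2 / 2)
        * ∑ q ∈ exponentBox n with weight q ≤ n, expTerm (logTerm (cumulant v) z x) q := by
      unfold expTerm logTerm
      fun_prop
    exact ((hd.contDiff.restrict_scalars ℝ).comp Complex.ofRealCLM.contDiff).contDiffAt
  have hRK' : ∀ τ, |τ| ≤ δ → ‖iteratedDeriv (n + 2) (logRemainder v (n + 2)) τ‖
      ≤ K * |τ| ^ (σ - (n + 2)) := fun τ hτ => by
    rw [iteratedDeriv_logRemainder_top (hLc τ (hτ.trans hδ))]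
    exact hRK τ hτ
  have key : ∀ t : ℝ, t ≠ 0 → |z * t| ≤ δ → |t ^ 3 * z| ≤ c ^ 3 → ∀ p ≤ n + 2,
      ‖iteratedDeriv p (powerFun v z) t - iteratedDeriv p (edgeworthApprox v (n + 2) z) t‖
        ≤ (|t| ^ expLow σ p + |t| ^ expHigh (n + 2) σ p) * Real.exp (-t ^ 2 / 2)
          * |z| ^ (σ - 2) * (C * 2 ^ (n + 3) * (K + |z| ^ (n + 3 - σ))) := by
    intro t ht h1 h2 p hp
    have hp' : ((p : ℕ) : WithTop ℕ∞) ≤ ((n + 2 : ℕ) : WithTop ℕ∞) := by exact_mod_cast hp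
    have h := hmain z hz hz1 K δ hK hKK₀ hδ hRK' t ht h1 h2 p hp
    rw [← iteratedDeriv_fun_sub ((hpc t (h1.trans hδ)).of_le hp') ((hac t).of_le hp')]
    rw [hpow, happ]
    refine h.trans ?_
    have h3 := rpow_add_rpow_mul_pow_le (n := n) (p := p) (σ := σ) (abs_pos.2 ht)
    have h4 : (2 : ℝ) ^ (p + 1) ≤ 2 ^ (n + 3) := pow_le_pow_right₀ (by norm_num) (by omega)
    calc _ = C * (K + |z| ^ (n + 3 - σ)) * |z| ^ (σ - 2) * Real.exp (-t ^ 2 / 2)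
          * ((|t| ^ σ + |t| ^ (3 * n + σ)) * (|t| + |t|⁻¹) ^ p) := by ring
      _ ≤ C * (K + |z| ^ (n + 3 - σ)) * |z| ^ (σ - 2) * Real.exp (-t ^ 2 / 2)
          * (2 ^ (n + 3) * (|t| ^ expLow σ p + |t| ^ expHigh (n + 2) σ p)) := by
        refine mul_le_mul_of_nonneg_left (h3.trans ?_) (by positivity)
        gcongr
      _ = _ := by ring
  intro t h1 h2 p hp
  rcases ne_or_eq t 0 with ht | rfl
  · exact key t ht h1 h2 p hp
  have hz' : |z * 0| < c := by simpa using hc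
  have hcont : ∀ {f : ℝ → ℂ}, ContDiffAt ℝ (n + 2 : ℕ) f 0 → ContinuousAt (iteratedDeriv p f) 0 :=
    fun hf => (contDiffAt_iteratedDeriv (k := 0) p hf (by omega)).continuousAt
  have hpR : (p : ℝ) ≤ n + 2 := by exact_mod_cast hp
  have hlow0 : 0 ≤ expLow σ p := by rw [expLow]; linarith
  have hhigh0 : 0 ≤ expHigh (n + 2) σ p := by
    rw [expHigh]; push_cast
    have := le_max_left (σ + (p : ℝ)) ((σ - 1) * p)
    have h3 : (0 : ℝ) ≤ p := Nat.cast_nonneg p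
    have h4 : (0 : ℝ) ≤ n := Nat.cast_nonneg n
    linarith
  have hl : ContinuousAt (fun t => ‖iteratedDeriv p (powerFun v z) t
      - iteratedDeriv p (edgeworthApprox v (n + 2) z) t‖) 0 :=
    ((hcont (hpc 0 hz'.le)).sub (hcont (hac 0))).norm
  have hr : ContinuousAt (fun t : ℝ => (|t| ^ expLow σ p + |t| ^ expHigh (n + 2) σ p)
      * Real.exp (-t ^ 2 / 2) * |z| ^ (σ - 2) * (C * 2 ^ (n + 3) * (K + |z| ^ (n + 3 - σ)))) 0 := by
    have a1 : ContinuousAt (fun t : ℝ => |t| ^ expLow σ p) 0 :=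
      continuous_abs.continuousAt.rpow_const (Or.inr hlow0)
    have a2 : ContinuousAt (fun t : ℝ => |t| ^ expHigh (n + 2) σ p) 0 :=
      continuous_abs.continuousAt.rpow_const (Or.inr hhigh0)
    have a3 : ContinuousAt (fun t : ℝ => Real.exp (-t ^ 2 / 2)) 0 := by fun_prop
    exact (((a1.add a2).mul a3).mul continuousAt_const).mul continuousAt_const
  refine le_of_tendsto_of_tendsto (hl.tendsto.mono_left (nhdsWithin_le_nhds (s := {0}ᶜ)))
    (hr.tendsto.mono_left nhdsWithin_le_nhds) ?_
  have ev1 : ∀ᶠ t in 𝓝 (0 : ℝ), |z * t| < δ :=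
    (show ContinuousAt (fun t : ℝ => |z * t|) 0 by fun_prop).eventually_lt_const (by simpa using hδ0)
  have ev2 : ∀ᶠ t in 𝓝 (0 : ℝ), |t ^ 3 * z| < c ^ 3 :=
    (show ContinuousAt (fun t : ℝ => |t ^ 3 * z|) 0 by fun_prop).eventually_lt_const
      (by simpa using pow_pos hc 3)
  filter_upwards [self_mem_nhdsWithin, nhdsWithin_le_nhds ev1, nhdsWithin_le_nhds ev2]
    with t ht h3 h4
  exact key t ht h3.le h4.le p hp

/-- A local bound by `|τ|^α` extends to a compact interval on which the function is continuous. -/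
theorem exists_forall_norm_le_mul_rpow {g : ℝ → ℂ} {c α : ℝ} (hα : 0 ≤ α)
    (hg : ∀ τ, |τ| ≤ c → ContinuousAt g τ) (hO : g =O[𝓝 0] fun τ : ℝ => |τ| ^ α) :
    ∃ K : ℝ, 0 < K ∧ ∀ τ, |τ| ≤ c → ‖g τ‖ ≤ K * |τ| ^ α := by
  obtain ⟨K₁, hK₁, h1⟩ := hO.exists_pos
  obtain ⟨δ, hδ, h2⟩ := Metric.eventually_nhds_iff.1 h1.bound
  have hcont : ContinuousOn g (Metric.closedBall 0 c) := fun τ hτ =>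
    (hg τ (by simpa using hτ)).continuousWithinAt
  obtain ⟨D, hD⟩ := (isCompact_closedBall (0 : ℝ) c).exists_bound_of_continuousOn hcont
  refine ⟨K₁ + |D| / δ ^ α, by positivity, fun τ hτ => ?_⟩
  have hτ0 : 0 ≤ |τ| ^ α := by positivity
  have hq : 0 ≤ |D| / δ ^ α := by positivity
  rcases lt_or_ge |τ| δ with h | h
  · have := h2 (show dist τ 0 < δ by simpa using h)
    rw [Real.norm_of_nonneg hτ0] at this
    exact this.trans (by gcongr; linarith)
  · have h3 : ‖g τ‖ ≤ |D| := (hD τ (by simpa using hτ)).trans (le_abs_self D)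
    have h4 : δ ^ α ≤ |τ| ^ α := Real.rpow_le_rpow hδ.le h hα
    calc ‖g τ‖ ≤ |D| / δ ^ α * δ ^ α := by
          rwa [div_mul_cancel₀ _ (by positivity : δ ^ α ≠ 0)]
      _ ≤ |D| / δ ^ α * |τ| ^ α := by gcongr
      _ ≤ _ := by gcongr; linarith

/-- Estimates with every constant `e > 0`, valid for `z` near `0`, amount to one estimate with a
null function `ε`: take for `ε z` the least admissible constant. -/
theorem exists_tendsto_zero_of_forall_pos {ι : Type*} (P : ℝ → ι → Prop) (a b : ℝ → ι → ℝ)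
    (hb : ∀ z i, 0 ≤ b z i) {C : ℝ} (hC : ∀ z i, P z i → a z i ≤ b z i * C)
    (h : ∀ e > 0, ∀ᶠ z in 𝓝[≠] (0 : ℝ), ∀ i, P z i → a z i ≤ b z i * e) :
    ∃ ε : ℝ → ℝ, Tendsto ε (𝓝[≠] 0) (𝓝 0) ∧ ∀ z i, P z i → a z i ≤ b z i * ε z := by
  let S : ℝ → Set ℝ := fun z => {e | 0 ≤ e ∧ ∀ i, P z i → a z i ≤ b z i * e}
  have hbdd : ∀ z, BddBelow (S z) := fun z => ⟨0, fun e he => he.1⟩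
  have hS : ∀ z, (S z).Nonempty := fun z => ⟨max C 0, le_max_right _ _, fun i hi =>
    (hC z i hi).trans (mul_le_mul_of_nonneg_left (le_max_left _ _) (hb z i))⟩
  refine ⟨fun z => sInf (S z), ?_, fun z i hi => ?_⟩
  · rw [Metric.tendsto_nhds]
    intro e he
    filter_upwards [h (e / 2) (half_pos he)] with z hz
    have h1 : sInf (S z) ≤ e / 2 := csInf_le (hbdd z) ⟨(half_pos he).le, hz⟩
    have h2 : 0 ≤ sInf (S z) := le_csInf (hS z) fun x hx => hx.1
    rw [Real.dist_eq, sub_zero, abs_of_nonneg h2]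
    linarith
  · rcases (hb z i).eq_or_lt' with h0 | h0
    · have := hC z i hi
      rw [h0, zero_mul] at this ⊢
      exact this
    · rw [← div_le_iff₀' h0]
      exact le_csInf (hS z) fun x hx => (div_le_iff₀' h0).2 (hx.2 i hi)

theorem abs_mul_le_of_abs_pow_three_mul_le {c z t δ : ℝ} (hδ : 0 ≤ δ)
    (hzδ : c ^ 3 * z ^ 2 ≤ δ ^ 3) (ht : |t ^ 3 * z| ≤ c ^ 3) : |z * t| ≤ δ := by
  refine le_of_pow_le_pow_left₀ three_ne_zero hδ (le_trans ?_ hzδ)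
  calc |z * t| ^ 3 = |t ^ 3 * z| * z ^ 2 := by
        rw [abs_mul, abs_mul, abs_pow, ← sq_abs z]; ring
    _ ≤ _ := by gcongr

theorem continuousAt_iteratedDeriv_logBranch_sub {v : ℝ → ℂ} {n : ℕ}
    (hv : ContDiff ℝ (n + 2 : ℕ) v) {c : ℝ} (hc : 0 < c) (hne : ∀ t : ℝ, |t| ≤ c → v t ≠ 0)
    (τ : ℝ) (hτ : |τ| ≤ c) : ContinuousAt (fun x => iteratedDeriv (n + 2) (logBranch v) x
      - iteratedDeriv (n + 2) (logBranch v) 0) τ :=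
  (contDiffAt_iteratedDeriv (k := 0) (n + 2) (contDiffAt_logBranch (N := n + 1) hv hc hne hτ)
    (by omega)).continuousAt.sub continuousAt_const

end Edgeworth

theorem proposition9p1 (s : ℝ) (hs : 2 ≤ s) (v : ℝ → ℂ)
    (hv : Edgeworth.TimesDifferentiable s v)
    (hv0 : v 0 = 1) (hv1 : deriv v 0 = 0) (hv2 : iteratedDeriv 2 v 0 = -1)
    (c : ℝ) (hc : 0 < c) (hne : ∀ t : ℝ, |t| ≤ c → v t ≠ 0) :
    (3 ≤ s →
      ∃ ε : ℝ → ℝ, Tendsto ε (𝓝[≠] 0) (𝓝 0) ∧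
        ∀ z : ℝ, 0 < |z| → |z| ≤ 1 → ∀ t : ℝ, |t ^ 3 * z| ≤ c ^ 3 → ∀ p : ℕ, p ≤ ⌊s⌋₊ →
          ‖iteratedDeriv p (Edgeworth.powerFun v z) t
              - iteratedDeriv p (Edgeworth.edgeworthApprox v ⌊s⌋₊ z) t‖
            ≤ (|t| ^ Edgeworth.expLow s p + |t| ^ Edgeworth.expHigh ⌊s⌋₊ s p)
              * Real.exp (-t ^ 2 / 2) * |z| ^ (s - 2) * ε z) ∧
    (ContDiff ℝ (⌊s⌋₊ + 1 : ℕ) v →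
      ∃ A : ℝ,
        ∀ z : ℝ, 0 < |z| → |z| ≤ 1 → ∀ t : ℝ, |t ^ 3 * z| ≤ c ^ 3 → ∀ p : ℕ, p ≤ ⌊s⌋₊ →
          ‖iteratedDeriv p (Edgeworth.powerFun v z) t
              - iteratedDeriv p (Edgeworth.edgeworthApprox v ⌊s⌋₊ z) t‖
            ≤ A * (|t| ^ Edgeworth.expLow ((⌊s⌋₊ : ℝ) + 1) p
                + |t| ^ Edgeworth.expHigh ⌊s⌋₊ ((⌊s⌋₊ : ℝ) + 1) p)
              * Real.exp (-t ^ 2 / 2) * |z| ^ ((⌊s⌋₊ : ℝ) - 1)) := by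
  obtain ⟨hvm, hlo⟩ := hv
  have hms : (⌊s⌋₊ : ℝ) ≤ s := Nat.floor_le (by linarith)
  have hsm : s < ⌊s⌋₊ + 1 := Nat.lt_floor_add_one s
  have hm2 : 2 ≤ ⌊s⌋₊ := Nat.le_floor (by exact_mod_cast hs)
  generalize ⌊s⌋₊ = m at *
  obtain ⟨n, rfl⟩ : ∃ n, m = n + 2 := ⟨m - 2, by omega⟩
  push_cast at hms hsm
  have hn : (0 : ℝ) ≤ n := Nat.cast_nonneg n
  have hzc : ∀ z : ℝ, |z| ≤ 1 → c ^ 3 * z ^ 2 ≤ c ^ 3 := fun z hz =>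
    mul_le_of_le_one_right (by positivity) ((sq_le_one_iff_abs_le_one z).2 hz)
  have hcont := Edgeworth.continuousAt_iteratedDeriv_logBranch_sub hvm hc hne
  constructor
  · intro hs3
    have hα : 0 ≤ s - (n + 2) := by linarith
    have ho := Edgeworth.isLittleO_iteratedDeriv_logBranch_sub (m := n + 2) (by omega) hvm hc hne
      hα (by linarith) (by simpa using hlo 0)
    obtain ⟨K₀, hK₀, hKbd⟩ := Edgeworth.exists_forall_norm_le_mul_rpow hα hcont ho.isBigO
    obtain ⟨C, hC, hmain⟩ := Edgeworth.exists_norm_iteratedDeriv_powerFun_sub_le hs3 hms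
      (by linarith : s ≤ n + 3) hc hK₀.le hvm hv0 hv1 hv2 hne
    refine (Edgeworth.exists_tendsto_zero_of_forall_pos
      (fun z (i : ℝ × ℕ) => (0 < |z| ∧ |z| ≤ 1) ∧ |i.1 ^ 3 * z| ≤ c ^ 3 ∧ i.2 ≤ n + 2)
      (fun z i => ‖iteratedDeriv i.2 (Edgeworth.powerFun v z) i.1
              - iteratedDeriv i.2 (Edgeworth.edgeworthApprox v (n + 2) z) i.1‖)
      (fun z i => (|i.1| ^ Edgeworth.expLow s i.2 + |i.1| ^ Edgeworth.expHigh (n + 2) s i.2)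
              * Real.exp (-i.1 ^ 2 / 2) * |z| ^ (s - 2))
      (fun z i => by positivity) (C := C * (K₀ + 1)) ?_ ?_).imp
        fun ε hε => ⟨hε.1, fun z hz hz1 t ht p hp => hε.2 z (t, p) ⟨⟨hz, hz1⟩, ht, hp⟩⟩
    · rintro z ⟨t, p⟩ ⟨⟨hz, hz1⟩, ht, hp⟩
      refine (hmain z hz hz1 K₀ c hK₀.le le_rfl hc le_rfl hKbd t
        (Edgeworth.abs_mul_le_of_abs_pow_three_mul_le hc.le (hzc z hz1) ht) ht p hp).trans ?_
      have : |z| ^ ((n : ℝ) + 3 - s) ≤ 1 := Real.rpow_le_one hz.le hz1 (by linarith)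
      dsimp only
      gcongr
    · intro e he
      set e' : ℝ := e / (2 * (C + 1)) with he'
      have he'0 : 0 < e' := by positivity
      have he'C : C * (e' + e') ≤ e := by
        have : (C + 1) * (e' + e') = e := by rw [he']; field_simp; ring
        nlinarith
      -- the constant for the remainder becomes small on a small interval, and `|z t|` is small
      obtain ⟨δ₁, hδ₁, hsmall⟩ := Metric.eventually_nhds_iff.1
        (ho.bound (lt_min hK₀ he'0))
      set δ := min (δ₁ / 2) c with hδ
      have hδ0 : 0 < δ := by positivity
      have ev1 : ∀ᶠ z in 𝓝 (0 : ℝ), c ^ 3 * z ^ 2 < δ ^ 3 :=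
        (show ContinuousAt (fun z : ℝ => c ^ 3 * z ^ 2) 0 by fun_prop).eventually_lt_const
          (by simpa using pow_pos hδ0 3)
      have hκ : 0 < (n : ℝ) + 3 - s := by linarith
      have ev2 : ∀ᶠ z in 𝓝 (0 : ℝ), |z| ^ ((n : ℝ) + 3 - s) < e' :=
        (continuous_abs.continuousAt.rpow_const (Or.inr hκ.le)).eventually_lt_const
          (by simpa [Real.zero_rpow hκ.ne'] using he'0)
      filter_upwards [nhdsWithin_le_nhds ev1, nhdsWithin_le_nhds ev2] with z h1 h2
      rintro ⟨t, p⟩ ⟨⟨hz, hz1⟩, ht, hp⟩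
      refine (hmain z hz hz1 (min K₀ e') δ (le_min hK₀.le he'0.le) (min_le_left _ _) hδ0
        (min_le_right _ _) (fun τ hτ => ?_) t
        (Edgeworth.abs_mul_le_of_abs_pow_three_mul_le hδ0.le h1.le ht) ht p hp).trans ?_
      · have hτ' : dist τ 0 < δ₁ := by
          have := hτ.trans (min_le_left _ _)
          rw [Real.dist_eq, sub_zero]
          linarith
        have := hsmall hτ'
        rwa [Real.norm_of_nonneg (by positivity : 0 ≤ |τ| ^ (s - ((n : ℝ) + 2)))] at this
      · have h3 : C * (min K₀ e' + |z| ^ ((n : ℝ) + 3 - s)) ≤ e :=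
          le_trans (by gcongr; exact min_le_right _ _) he'C
        dsimp only
        gcongr
  · intro hvs
    have hO : (fun τ => iteratedDeriv (n + 2) (Edgeworth.logBranch v) τ
        - iteratedDeriv (n + 2) (Edgeworth.logBranch v) 0) =O[𝓝 0] fun τ : ℝ => |τ| ^ (1 : ℝ) := by
      simpa using Edgeworth.isBigO_iteratedDeriv_logBranch_sub hvs hc hne
    obtain ⟨K₀, hK₀, hKbd⟩ := Edgeworth.exists_forall_norm_le_mul_rpow zero_le_one hcont hO
    obtain ⟨C, hC, hmain⟩ := Edgeworth.exists_norm_iteratedDeriv_powerFun_sub_le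
      (σ := (n : ℝ) + 3) (by linarith) (by linarith) le_rfl hc hK₀.le hvm hv0 hv1 hv2 hne
    refine ⟨C * (K₀ + 1), fun z hz hz1 t ht p hp => ?_⟩
    have h := hmain z hz hz1 K₀ c hK₀.le le_rfl hc le_rfl
      (by rwa [show (n : ℝ) + 3 - (n + 2) = 1 by ring]) t
      (Edgeworth.abs_mul_le_of_abs_pow_three_mul_le hc.le (hzc z hz1) ht) ht p hp
    rw [sub_self, Real.rpow_zero, show (n : ℝ) + 3 - 2 = n + 1 by ring] at h
    rw [show ((n + 2 : ℕ) : ℝ) + 1 = n + 3 by push_cast; ring,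
      show ((n + 2 : ℕ) : ℝ) - 1 = n + 1 by push_cast; ring]
    exact h.trans_eq (by ring)
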